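/- Let $\mathbb F$ be a field and $n \ge 1$. Let $X$ be a regular $n$-dimensional CW complex; here a (Hausdorff) CW complex is \emph{regular} if it is compact and all its attaching maps are embeddings, and it is \emph{$n$-dimensional} if the union of its open $n$-cells is an open dense subset of $X$. Let $X_n$ be the set of $n$-cells of $X$, and let $\partial_n \colon C_n(X;\mathbb F) \to C_{n-1}(X;\mathbb F)$ be the cellular boundary operator. The degree-$n$ cellular matroid $M_n(X)$ is the linear matroid on the columns of $\partial_n$: its ground set is $X_n$, and a set $I \subseteq X_n$ is independent if and only if the family $(\partial_n e)_{e \in I}$ is linearly independent over $\mathbb F$. Let $r$ denote its rank function. For $E \subseteq X_n$ let $\overline{E}$ denote the closure in $X$ of the union of the cells in $E$; since $X$ is regular, such closures and their intersections are subcomplexes of $X$. Let $E_1, E_2$ be a partition of $X_n$ into two disjoint nonempty subsets. Then $$ r(M_n(X)) \;=\; r(E_1) + r(E_2) - \eta_{n-1}(E_1,E_2), $$ where $\eta_{n-1}(E_1,E_2)$ is the nullity (the dimension of the kernel) of the map $$ \tilde H_{n-1}(\overline{E_1} \cap \overline{E_2};\mathbb F) \;\longrightarrow\; \tilde H_{n-1}(\overline{E_1};\mathbb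 F) \oplus \tilde H_{n-1}(\overline{E_2};\mathbb F) $$ on reduced cellular homology induced by the inclusions. -/

import Mathlib

open CategoryTheory CategoryTheory.Limits AlgebraicTopology

noncomputable section

namespace CellularMatroid

universe u v

/-! ### Linear matroids -/

/-- The linear matroid of a family of vectors `v : α → V` over a field `F`: the ground set is `α`,
and `I ⊆ α` is independent iff the subfamily `(v a)_{a ∈ I}` is linearly independent. -/
def linearMatroid (F : Type*) [Field F] {α V : Type*} [AddCommGroup V] [Module F V]
    (v : α → V) : Matroid α :=
  (IndepMatroid.ofFinitaryCardAugment (E := Set.univ) (Indep := fun I => LinearIndepOn F v I)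
    (indep_empty := linearIndepOn_empty F v)
    (indep_subset := fun _ _ hJ hIJ => hJ.mono hIJ)
    (indep_aug := by
      intro I J hI hIfin hJ hJfin hlt
      by_contra! hcon
      have hspan : v '' J ⊆ Submodule.span F (v '' I) := by
        rintro _ ⟨e, he, rfl⟩
        by_contra hne
        have heI : e ∉ I := fun h => hne (Submodule.subset_span ⟨e, h, rfl⟩)
        exact hcon e he heI (hI.insert hne)
      have hle : Submodule.span F (v '' J) ≤ Submodule.span F (v '' I) :=
        Submodule.span_le.2 hspan
      have : Fintype I := hIfin.fintype
      have : Fintype J := hJfin.fintype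
      have hcard : ∀ (K : Set α) [Fintype K], LinearIndepOn F v K →
          Module.finrank F (Submodule.span F (v '' K)) = K.ncard := by
        intro K _ hK
        have h := finrank_span_eq_card (R := F) (b := fun x : K => v x) hK
        rw [← Set.image_eq_range, ← Nat.card_eq_fintype_card] at h
        exact h
      have : FiniteDimensional F (Submodule.span F (v '' I)) :=
        FiniteDimensional.span_of_finite F (hIfin.image v)
      have := Submodule.finrank_mono hle
      rw [hcard J hJ, hcard I hI] at this
      omega)
    (indep_compact := fun I hI => linearIndepOn_of_finite I fun t ht hfin => hI t ht hfin)
    (subset_ground := fun _ _ => Set.subset_univ _)).matroid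

/-! ### Singular homology of spaces and pairs -/

section Homology

variable (F : Type v) [Field F]

/-- The singular chain complex with coefficients in `F`. The coefficient module is
`F`, moved to a universe that also contains the spaces. -/
def singularChains : TopCat.{u} ⥤ ChainComplex (ModuleCat.{max u v} F) ℕ :=
  (singularChainComplexFunctor (ModuleCat.{max u v} F)).obj (ModuleCat.of F (ULift.{u} F))

/-- Singular homology `H_k(P; F)`. -/
def homology (k : ℕ) : TopCat.{u} ⥤ ModuleCat.{max u v} F :=
  singularChains F ⋙ HomologicalComplex.homologyFunctor _ _ k

/-- The relative singular chain complex of a map `Q ⟶ P`: the cokernel of the map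
on singular chains. For an inclusion of subspaces this is `S(P) / S(Q)`. -/
def relChains : Arrow TopCat.{u} ⥤ ChainComplex (ModuleCat.{max u v} F) ℕ :=
  (singularChains F).mapArrow ⋙ coker _

/-- Relative singular homology `H_k(P, Q; F)`. -/
def relHomology (k : ℕ) : Arrow TopCat.{u} ⥤ ModuleCat.{max u v} F :=
  relChains F ⋙ HomologicalComplex.homologyFunctor _ _ k

/-- The sequence `S(Q) ⟶ S(P) ⟶ S(P) / S(Q)`. -/
def pairSequence (i : Arrow TopCat.{u}) :
    ShortComplex (ChainComplex (ModuleCat.{max u v} F) ℕ) :=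
  ShortComplex.mk ((singularChains F).map i.hom) (cokernel.π ((singularChains F).map i.hom))
    (cokernel.condition _)

lemma pairSequence_shortExact (i : Arrow TopCat.{u}) [Mono i.hom] :
    (pairSequence F i).ShortExact := by
  have : Mono (pairSequence F i).f := by
    have : (singularChains.{u, v} F).PreservesMonomorphisms := by
      unfold singularChains; infer_instance
    exact this.preserves i.hom
  have : Epi (pairSequence F i).g := by
    dsimp [pairSequence]; infer_instance
  exact { exact := ShortComplex.exact_cokernel _ }

/-- The map `H_k(P; F) ⟶ H_k(P, Q; F)`. -/
def toRel (k : ℕ) (i : Arrow TopCat.{u}) :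
    (homology F k).obj i.right ⟶ (relHomology F k).obj i :=
  (HomologicalComplex.homologyFunctor _ _ k).map (pairSequence F i).g

/-- The connecting homomorphism `H_{k+1}(P, Q; F) ⟶ H_k(Q; F)` of the long exact sequence
of a pair. -/
def connecting (k : ℕ) (i : Arrow TopCat.{u}) [Mono i.hom] :
    (relHomology F (k + 1)).obj i ⟶ (homology F k).obj i.left :=
  (pairSequence_shortExact F i).δ (k + 1) k (by simp)

end Homology

/-- The pair `(P, Q)` of subspaces of `X`, for `Q ⊆ P`. -/
def pair {X : Type u} [TopologicalSpace X] {Q P : Set X} (h : Q ⊆ P) : Arrow TopCat.{u} :=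
  Arrow.mk (TopCat.ofHom ⟨Set.inclusion h, continuous_inclusion h⟩ : TopCat.of Q ⟶ TopCat.of P)

instance {X : Type u} [TopologicalSpace X] {Q P : Set X} (h : Q ⊆ P) : Mono (pair h).hom :=
  (TopCat.mono_iff_injective _).2 (Set.inclusion_injective h)

/-- The inclusion of pairs `(P, Q) ⟶ (P', Q')`, for `P ⊆ P'` and `Q ⊆ Q'`. -/
def pairMap {X : Type u} [TopologicalSpace X] {Q P Q' P' : Set X} (h : Q ⊆ P) (h' : Q' ⊆ P')
    (hQ : Q ⊆ Q') (hP : P ⊆ P') : pair h ⟶ pair h' :=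
  Arrow.homMk (TopCat.ofHom ⟨Set.inclusion hQ, continuous_inclusion hQ⟩)
    (TopCat.ofHom ⟨Set.inclusion hP, continuous_inclusion hP⟩) rfl

/-! ### CW complexes and their cellular chains

Throughout, `X` is a Hausdorff space with a CW structure on the whole space. -/

section CW

open Topology Topology.RelCWComplex

variable (X : Type u) [TopologicalSpace X] [T2Space X] [CWComplex (Set.univ : Set X)]

/-- The type `X_k` of `k`-cells of `X`. -/
abbrev Cell (k : ℕ) : Type u := cell (Set.univ : Set X) k

/-- `X` is regular: it is compact, and the attaching map of every cell is an embedding. -/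
structure IsRegular : Prop where
  compact : CompactSpace X
  isEmbedding : ∀ (k : ℕ) (e : Cell X k),
    IsEmbedding ((Metric.sphere (0 : Fin k → ℝ) 1).domRestrict (map (C := Set.univ) k e))

/-- `X` is `n`-dimensional: the union of its (open) `n`-cells is an open dense subset. -/
structure IsOfDim (n : ℕ) : Prop where
  isOpen : IsOpen (⋃ e : Cell X n, openCell n e)
  dense : Dense (⋃ e : Cell X n, openCell n e)

variable {X} in
/-- The closure `Ē` in `X` of the union of the cells in `E`. -/
def cellClosure {k : ℕ} (E : Set (Cell X k)) : Set X := closure (⋃ e ∈ E, openCell k e)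

/-- The pair `(X^k, X^{k-1})` of skeleta (here `skeletonLT _ m` is the union of the
cells of dimension less than `m`, so that `X^{-1} = ∅`). -/
def skeletonPair (k : ℕ) : Arrow TopCat.{u} :=
  pair (X := X) (Q := skeletonLT (Set.univ : Set X) (k : ℕ))
    (P := skeletonLT (Set.univ : Set X) ((k + 1 : ℕ) : ℕ∞)) (skeletonLT_mono (by simp))

instance (k : ℕ) : Mono (skeletonPair X k).hom := by
  unfold skeletonPair; infer_instance

variable (F : Type v) [Field F]

/-- The cellular chain group `C_k(X; F) = H_k(X^k, X^{k-1}; F)`. -/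
abbrev CellularChain (k : ℕ) : ModuleCat.{max u v} F := (relHomology F k).obj (skeletonPair X k)

/-- The cellular boundary operator `∂_{k+1} : C_{k+1}(X; F) → C_k(X; F)`, i.e. the composite
`H_{k+1}(X^{k+1}, X^k) → H_k(X^k) → H_k(X^k, X^{k-1})`. -/
def boundary (k : ℕ) : CellularChain X F (k + 1) →ₗ[F] CellularChain X F k :=
  (connecting F k (skeletonPair X (k + 1)) ≫ toRel F k (skeletonPair X k)).hom

variable {X} in
/-- An orientation of a cell `e` of dimension `k`: a (chosen) generator of the one-dimensional
space `H_k(ē, ∂e; F)`. -/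
def orientation {k : ℕ} (e : Cell X k) :
    (relHomology F k).obj (pair (cellFrontier_subset_closedCell k e)) :=
  Classical.epsilon fun g => Submodule.span F {g} = ⊤

variable {X} in
/-- The basis element of `C_k(X; F)` given by the (oriented) cell `e`: the image of the orientation
under `H_k(ē, ∂e) → H_k(X^k, X^{k-1})`. -/
def cellClass {k : ℕ} (e : Cell X k) : CellularChain X F k :=
  ((relHomology F k).map (pairMap (cellFrontier_subset_closedCell k e) _
    (cellFrontier_subset_skeletonLT k e)
    (closedCell_subset_skeletonLT k e))).hom (orientation F e)

/-- The degree-`k` cellular matroid `M_k(X)` with coefficients in `F`: the linear matroid on the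
columns `∂_k e` (`e ∈ X_k`) of the cellular boundary operator `∂_k`; here `∂_0 = 0`. -/
def cellularMatroid : (k : ℕ) → Matroid (Cell X k)
  | 0 => linearMatroid F fun _ : Cell X 0 => (0 : F)
  | k + 1 => linearMatroid F fun e : Cell X (k + 1) => boundary X F k (cellClass F e)

/-! ### Reduced cellular homology of subcomplexes

For a subcomplex `A` of `X` (given by its underlying set), the cells of `A` are the cells of `X`
contained in `A`, and the cellular chain complex of `A` is the subcomplex of the one of `X` that
these cells span. -/

variable {X}

/-- The cellular chain group `C_k(A; F)` of a subcomplex `A`, as a subspace of `C_k(X; F)`. -/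
def chainsIn (k : ℕ) (A : Set X) : Submodule F (CellularChain X F k) :=
  Submodule.span F {c | ∃ e : Cell X k, openCell k e ⊆ A ∧ c = cellClass F e}

variable (X) in
/-- The kernel of `∂_k` in the augmented cellular chain complex of `X`. In degree `0` this is
the kernel of the augmentation `C_0(X; F) = H_0(X^0; F) → F`. -/
def reducedCycles : (k : ℕ) → Submodule F (CellularChain X F k)
  | 0 => (LinearMap.ker (TopCat.singularHomology₀ε (skeletonPair X 0).right
      (ModuleCat.of F (ULift.{u} F))).hom).map (toRel F 0 (skeletonPair X 0)).hom
  | k + 1 => LinearMap.ker (boundary X F k)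

/-- The reduced cellular cycles of a subcomplex `A`. -/
def cyclesIn (k : ℕ) (A : Set X) : Submodule F (CellularChain X F k) :=
  chainsIn F k A ⊓ reducedCycles X F k

/-- The cellular boundaries of a subcomplex `A`, i.e. the image of `C_{k+1}(A; F)` under
`∂_{k+1}`. -/
def boundariesIn (k : ℕ) (A : Set X) : Submodule F (CellularChain X F k) :=
  (chainsIn F (k + 1) A).map (boundary X F k)

/-- The reduced cellular homology `H̃_k(A; F)` of a subcomplex `A`: cycles modulo boundaries. -/
abbrev ReducedHomology (k : ℕ) (A : Set X) : Type (max u v) :=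
  cyclesIn F k A ⧸ (boundariesIn F k A).comap (cyclesIn F k A).subtype

variable {F} in
lemma chainsIn_mono (k : ℕ) {A B : Set X} (h : A ⊆ B) : chainsIn F k A ≤ chainsIn F k B :=
  Submodule.span_mono fun _ ⟨e, he, hc⟩ => ⟨e, he.trans h, hc⟩

/-- The map `H̃_k(A; F) → H̃_k(B; F)` induced by the inclusion of subcomplexes `A ⊆ B`. -/
def inclusionMap (k : ℕ) {A B : Set X} (h : A ⊆ B) :
    ReducedHomology F k A →ₗ[F] ReducedHomology F k B :=
  Submodule.mapQ _ _ (Submodule.inclusion (inf_le_inf_right _ (chainsIn_mono k h)))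
    fun _ hx => Submodule.map_mono (chainsIn_mono (k + 1) h) hx

/-- The nullity (dimension of the kernel) of the map `H̃_k(A ∩ B; F) → H̃_k(A; F) ⊕ H̃_k(B; F)`
induced by the inclusions. -/
def nullity (k : ℕ) (A B : Set X) : ℕ∞ :=
  Cardinal.toENat <| Module.rank F <| LinearMap.ker <|
    (inclusionMap F k (A := A ∩ B) (B := A) Set.inter_subset_left).prod
      (inclusionMap F k (A := A ∩ B) (B := B) Set.inter_subset_right)

end CW

end CellularMatroid

end

/-! Let V₁ and V₂ be the spans of the columns ∂e with e in E₁ and in E₂. The rank of a set of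
columns is the dimension of its span, so the formula is dim(V₁ + V₂) + dim(V₁ ∩ V₂) = dim V₁ + dim
V₂ (`linearMatroid_eRank_add`) as soon as the nullity is known to be dim(V₁ ∩ V₂).

Let A and B be the closures of E₁ and E₂. The top cells inside A are exactly those of E₁, so V₁ is
the space of boundaries of A, and likewise V₂ for B (`boundariesIn_cellClosure`). No top cell lies
in A ∩ B, so its homology one degree below the top is just its space of cycles. The kernel therefore
consists of the cycles of A ∩ B that lie in V₁ ∩ V₂ (`nullity_eq`), and what remains is that all of
V₁ ∩ V₂ consists of cycles of A ∩ B. Boundaries are reduced cycles by `boundary_mem_reducedCycles`;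
that they are chains of A ∩ B is `span_boundary_cellClass_inf_le`.

The latter is a local argument. For p outside X^{n-1}, cellular n-chains map to the local homology
H_n(X^n, X^n \ p) by `localize`. The boundary of a cell dies there unless p lies on the frontier of
the cell, so an element of V₁ ∩ V₂ dies at every p outside A ∩ B. An n-cell not contained in A ∩ B
has such a point in its interior, every other n-cell dies at that point, and hence the term of this
cell in the expansion of the chain is zero.

Cellular chains are defined by singular homology, so three facts about cells are needed: H_n of a
closed cell modulo its frontier has a generator (`exists_span_singleton_relHomology_cube`), cells
span the chains (`span_range_cellClass`), and a multiple of a cell that vanishes locally at an inner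
point vanishes (`smul_cellClass_eq_zero`). They follow from excision, proved by barycentric
subdivision, from the deformation of a punctured cube onto its boundary, and from the long exact
sequence. Linear independence of the cells is never needed. -/

open CategoryTheory CategoryTheory.Limits AlgebraicTopology

noncomputable section

namespace CellularMatroid

universe u v w

/-! ### Bases of singular chains -/

section Chains

variable (F : Type v) [Field F]

/-- The topological simplex. -/
abbrev Simplex (n : ℕ) : Type := stdSimplex ℝ (Fin (n + 1))

/-- The affine map of topological simplices induced by a map on vertices. -/
def simplexMap {m n : ℕ} (f : Fin (m + 1) → Fin (n + 1)) : C(Simplex m, Simplex n) :=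
  ⟨stdSimplex.map f, stdSimplex.continuous_map f⟩

/-- The `n`-simplices of the singular simplicial set. -/
def singularEquiv (X : TopCat.{u}) (n : ℕ) :
    C(Simplex n, X) ≃ (TopCat.toSSet.obj X).obj (.op (SimplexCategory.mk n)) :=
  (TopCat.toSSetObjEquiv X (.op (SimplexCategory.mk n))).symm

variable {F} in
/-- The singular chain given by a singular simplex. -/
def singularSimplex {X : TopCat.{u}} {n : ℕ} (σ : C(Simplex n, X)) :
    ((singularChains.{u, v} F).obj X).X n :=
  ((TopCat.toSSet.obj X).ιChainComplex (R := ModuleCat.of F (ULift.{u} F))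
    (singularEquiv X n σ)).hom ⟨1⟩

lemma singularChains_map_singularSimplex {X Y : TopCat.{u}} (f : X ⟶ Y) {n : ℕ}
    (σ : C(Simplex n, X)) :
    (((singularChains F).map f).f n).hom (singularSimplex σ) =
      singularSimplex (f.hom.comp σ) := by
  have := SSet.ι_chainComplexMap_f _ _ (TopCat.toSSet.map f) (ModuleCat.of F (ULift.{u} F))
    (singularEquiv X n σ)
  exact congr(($this).hom ⟨1⟩)

lemma singularChains_d_singularSimplex {X : TopCat.{u}} {n : ℕ} (σ : C(Simplex (n + 1), X)) :
    (((singularChains F).obj X).d (n + 1) n).hom (singularSimplex σ) =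
      ∑ i : Fin (n + 2), (-1 : F) ^ i.val • singularSimplex (σ.comp (simplexMap i.succAbove)) := by
  have := SSet.ιChainComplex_d (TopCat.toSSet.obj X) (R := ModuleCat.of F (ULift.{u} F))
    (singularEquiv X (n + 1) σ)
  refine (congr(($this).hom ⟨1⟩)).trans ?_
  simp only [ModuleCat.hom_sum, LinearMap.sum_apply]
  refine Finset.sum_congr rfl fun i _ => ?_
  rw [ModuleCat.hom_smul, LinearMap.smul_apply, ← Int.cast_smul_eq_zsmul F]
  congr 1
  push_cast
  rfl

/-- The coordinates of a singular chain. -/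
def singularRepr (X : TopCat.{u}) (n : ℕ) :
    ((singularChains.{u, v} F).obj X).X n ⟶
      ModuleCat.of F (C(Simplex n, X) →₀ ULift.{u} F) :=
  Cofan.IsColimit.desc (SSet.isColimitChainComplexXCofan (TopCat.toSSet.obj X)
    (ModuleCat.of F (ULift.{u} F)) n) fun σ =>
      ModuleCat.ofHom (Finsupp.lsingle ((singularEquiv X n).symm σ))

lemma singularRepr_singularSimplex {X : TopCat.{u}} {n : ℕ} (σ : C(Simplex n, X)) :
    (singularRepr F X n).hom (singularSimplex σ) = Finsupp.single σ 1 := by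
  have := Cofan.IsColimit.fac (SSet.isColimitChainComplexXCofan (TopCat.toSSet.obj X)
    (ModuleCat.of F (ULift.{u} F)) n) (fun σ =>
      ModuleCat.ofHom (Finsupp.lsingle (R := F) (M := ULift.{u} F) ((singularEquiv X n).symm σ)))
      (singularEquiv X n σ)
  refine (congr(($this).hom ⟨1⟩)).trans ?_
  simp
  rfl

variable {F} in
lemma singularChains_hom_ext {X : TopCat.{u}} {n : ℕ} {M : ModuleCat.{max u v} F}
    {f g : ((singularChains.{u, v} F).obj X).X n ⟶ M}
    (h : ∀ σ : C(Simplex n, X), f.hom (singularSimplex σ) = g.hom (singularSimplex σ)) :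
    f = g := by
  refine Cofan.IsColimit.hom_ext (SSet.isColimitChainComplexXCofan (TopCat.toSSet.obj X)
    (ModuleCat.of F (ULift.{u} F)) n) _ _ fun x => ?_
  obtain ⟨σ, rfl⟩ := (singularEquiv X n).surjective x
  refine ModuleCat.hom_ext (LinearMap.ext fun c => ?_)
  have hc : c = c.down • (⟨1⟩ : ULift.{u} F) := ULift.ext _ _ (by simp)
  rw [hc, map_smul, map_smul]
  exact congr(c.down • $(h σ))

/-- The singular simplices form a basis of the singular chains. -/
def singularBasis (X : TopCat.{u}) (n : ℕ) :
    Module.Basis C(Simplex n, X) F (((singularChains.{u, v} F).obj X).X n) :=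
  .mk (v := singularSimplex)
    (by
      let f : ((singularChains.{u, v} F).obj X).X n →ₗ[F] (C(Simplex n, X) →₀ F) :=
        (Finsupp.mapRange.linearMap
          (ULift.moduleEquiv.{v, v, u} (R := F) (M := F)).toLinearMap) ∘ₗ (singularRepr F X n).hom
      refine LinearIndependent.of_comp f ?_
      have : f ∘ singularSimplex (F := F) = Finsupp.basisSingleOne := by
        ext σ : 1
        refine (congrArg (Finsupp.mapRange.linearMap
          (ULift.moduleEquiv.{v, v, u} (R := F) (M := F)).toLinearMap)
          (singularRepr_singularSimplex F σ)).trans ?_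
        simp
      rw [this]
      exact Finsupp.basisSingleOne.linearIndependent)
    (by
      let p := (Submodule.span F (Set.range (singularSimplex (F := F) (X := X) (n := n))))
      have : ModuleCat.ofHom p.mkQ = 0 := singularChains_hom_ext fun σ =>
        (Submodule.Quotient.mk_eq_zero p).2 (Submodule.subset_span ⟨σ, rfl⟩)
      intro x _
      simpa using congr(($this).hom x))

@[simp]
lemma singularBasis_apply (X : TopCat.{u}) (n : ℕ) (σ : C(Simplex n, X)) :
    singularBasis F X n σ = singularSimplex σ := by
  simp [singularBasis]

end Chains

/-! ### Representatives of homology classes -/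

section Represents

variable {F : Type v} [Field F] (K L : ChainComplex (ModuleCat.{w} F) ℕ) (k : ℕ)

/-- The chain `x` is a cycle that represents the homology class `h`. -/
def Represents (x : K.X k) (h : K.homology k) : Prop :=
  ∃ z : K.cycles k, (K.iCycles k).hom z = x ∧ (K.homologyπ k).hom z = h

variable {K L k}

lemma exists_represents (h : K.homology k) : ∃ x, Represents K k x h := by
  obtain ⟨z, hz⟩ := (ModuleCat.epi_iff_surjective (K.homologyπ k)).1 inferInstance h
  exact ⟨_, z, rfl, hz⟩

lemma exists_represents_of_cycle {x : K.X k} (hx : ∀ j, (K.d k j).hom x = 0) :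
    ∃ h, Represents K k x h := by
  have hS := ShortComplex.exact_of_f_is_kernel
    (ShortComplex.mk (K.iCycles k) (K.d k _) (K.iCycles_d k _)) (K.cyclesIsKernel k _ rfl)
  obtain ⟨z, hz⟩ := (ShortComplex.moduleCat_exact_iff _).1 hS x (hx _)
  exact ⟨_, z, hz, rfl⟩

namespace Represents

variable {x y : K.X k} {h h' : K.homology k}

lemma d_eq_zero (hx : Represents K k x h) (j : ℕ) : (K.d k j).hom x = 0 := by
  obtain ⟨z, rfl, -⟩ := hx
  exact congr(($(K.iCycles_d k j)).hom z)

lemma eq_zero_iff (hx : Represents K k x h) : h = 0 ↔ ∃ u, (K.d (k + 1) k).hom u = x := by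
  obtain ⟨z, rfl, rfl⟩ := hx
  have hS := ShortComplex.exact_of_g_is_cokernel
    (ShortComplex.mk (K.toCycles (k + 1) k) (K.homologyπ k) (K.toCycles_comp_homologyπ _ _))
    (K.homologyIsCokernel (k + 1) k (by simp))
  have hi := (ModuleCat.mono_iff_injective (K.iCycles k)).1 inferInstance
  have hcomp (u) : (K.iCycles k).hom ((K.toCycles (k + 1) k).hom u) = (K.d (k + 1) k).hom u :=
    congr(($(K.toCycles_i (k + 1) k)).hom u)
  refine ⟨fun h0 => ?_, fun ⟨u, hu⟩ => ?_⟩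
  · obtain ⟨u, hu⟩ := (ShortComplex.moduleCat_exact_iff _).1 hS z h0
    exact ⟨u, by rw [← hcomp]; exact congrArg _ hu⟩
  · rw [← hcomp] at hu
    rw [← hi hu]
    exact congr(($(K.toCycles_comp_homologyπ (k + 1) k)).hom u)

lemma map (f : K ⟶ L) (hx : Represents K k x h) :
    Represents L k ((f.f k).hom x) ((HomologicalComplex.homologyMap f k).hom h) := by
  obtain ⟨z, rfl, rfl⟩ := hx
  exact ⟨(HomologicalComplex.cyclesMap f k).hom z,
    congr(($(HomologicalComplex.cyclesMap_i f k)).hom z),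
    congr(($(HomologicalComplex.homologyπ_naturality f k)).hom z).symm⟩

lemma sub (hx : Represents K k x h) (hy : Represents K k y h') :
    Represents K k (x - y) (h - h') := by
  obtain ⟨z, rfl, rfl⟩ := hx
  obtain ⟨z', rfl, rfl⟩ := hy
  exact ⟨z - z', map_sub _ _ _, map_sub _ _ _⟩

end Represents

end Represents

/-! ### Relative cycles and relative boundaries at the level of singular chains. -/

section RelRepresents

variable {F : Type v} [Field F] {i j : Arrow TopCat.{u}} {k : ℕ}

variable (F) in
/-- The map on singular chains given by a continuous map. -/
def chainMap {P Q : TopCat.{u}} (f : P ⟶ Q) (k : ℕ) :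
    ((singularChains.{u, v} F).obj P).X k →ₗ[F] ((singularChains.{u, v} F).obj Q).X k :=
  (((singularChains F).map f).f k).hom

variable (F) in
/-- The differential of singular chains. -/
def chainD (P : TopCat.{u}) (k l : ℕ) :
    ((singularChains.{u, v} F).obj P).X k →ₗ[F] ((singularChains.{u, v} F).obj P).X l :=
  (((singularChains F).obj P).d k l).hom

lemma chainMap_chainD {P Q : TopCat.{u}} (f : P ⟶ Q) (k l : ℕ)
    (x : ((singularChains.{u, v} F).obj P).X k) :
    chainMap F f l (chainD F P k l x) = chainD F Q k l (chainMap F f k x) :=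
  congr(($(((singularChains F).map f).comm k l)).hom x).symm

lemma chainD_chainD (P : TopCat.{u}) (k l m : ℕ) (x : ((singularChains.{u, v} F).obj P).X k) :
    chainD F P l m (chainD F P k l x) = 0 :=
  congr(($(((singularChains F).obj P).d_comp_d k l m)).hom x)

lemma chainMap_comp {P Q R : TopCat.{u}} (f : P ⟶ Q) (g : Q ⟶ R) (k : ℕ)
    (x : ((singularChains.{u, v} F).obj P).X k) :
    chainMap F (f ≫ g) k x = chainMap F g k (chainMap F f k x) := by
  simp [chainMap]

lemma chainMap_injective {P Q : TopCat.{u}} (f : P ⟶ Q) [Mono f] (k : ℕ) :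
    Function.Injective (chainMap F f k) := by
  have : (singularChains.{u, v} F).PreservesMonomorphisms := by
    unfold singularChains; infer_instance
  exact (ModuleCat.mono_iff_injective (((singularChains F).map f).f k)).1 inferInstance

variable (F) in
/-- The projection `S(P) ⟶ S(P) / S(Q)`. -/
def relProj (i : Arrow TopCat.{u}) (k : ℕ) :
    ((singularChains.{u, v} F).obj i.right).X k →ₗ[F] ((relChains F).obj i).X k :=
  ((pairSequence F i).g.f k).hom

/-- The singular chain `c` of `P` is a cycle relative to `Q` and represents the class `h` in
`H_k(P, Q)`. -/
def RelRepresents (i : Arrow TopCat.{u}) (k : ℕ) (c : ((singularChains.{u, v} F).obj i.right).X k)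
    (h : (relHomology F k).obj i) : Prop :=
  Represents ((relChains F).obj i) k (relProj F i k c) h

variable (F) in
lemma relProj_surjective (i : Arrow TopCat.{u}) (k : ℕ) :
    Function.Surjective (relProj F i k) := by
  have : Epi (pairSequence F i).g := by
    dsimp [pairSequence]; infer_instance
  exact (ModuleCat.epi_iff_surjective ((pairSequence F i).g.f k)).1 inferInstance

lemma relProj_eq_zero_iff [Mono i.hom] (c : ((singularChains.{u, v} F).obj i.right).X k) :
    relProj F i k c = 0 ↔ ∃ q, chainMap F i.hom k q = c := by
  have h := ((pairSequence_shortExact F i).map_of_exact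
    (HomologicalComplex.eval (ModuleCat.{max u v} F) (ComplexShape.down ℕ) k)).exact
  exact ⟨fun h0 => (ShortComplex.moduleCat_exact_iff _).1 h c h0, fun ⟨q, hq⟩ => by
    rw [← hq]
    exact congr((($((pairSequence F i).zero)).f k).hom q)⟩

lemma relProj_chainD (k l : ℕ) (c : ((singularChains.{u, v} F).obj i.right).X k) :
    ((((relChains F).obj i).d k l).hom (relProj F i k c)) =
      relProj F i l (chainD F i.right k l c) :=
  congr(($((pairSequence F i).g.comm k l)).hom c)

lemma exists_relRepresents (h : (relHomology F k).obj i) : ∃ c, RelRepresents i k c h := by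
  obtain ⟨x, hx⟩ := exists_represents h
  obtain ⟨c, rfl⟩ := relProj_surjective F i k x
  exact ⟨c, hx⟩

lemma exists_relRepresents_of_cycle [Mono i.hom] {c : ((singularChains.{u, v} F).obj i.right).X k}
    (hc : ∀ l, ∃ q, chainMap F i.hom l q = chainD F i.right k l c) :
    ∃ h : (relHomology F k).obj i, RelRepresents i k c h :=
  exists_represents_of_cycle fun l => by
    rw [relProj_chainD, relProj_eq_zero_iff]
    exact hc l

namespace RelRepresents

variable {c c' : ((singularChains.{u, v} F).obj i.right).X k} {h h' : (relHomology F k).obj i}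

lemma exists_chainD_eq [Mono i.hom] (hc : RelRepresents i k c h) (l : ℕ) :
    ∃ q, chainMap F i.hom l q = chainD F i.right k l c := by
  rw [← relProj_eq_zero_iff, ← relProj_chainD]
  exact hc.d_eq_zero l

lemma sub (hc : RelRepresents i k c h) (hc' : RelRepresents i k c' h') :
    RelRepresents i k (c - c') (h - h') := by
  unfold RelRepresents
  rw [map_sub]
  exact Represents.sub hc hc'

lemma eq_zero_iff [Mono i.hom] (hc : RelRepresents i k c h) :
    h = 0 ↔ ∃ u q, c = chainD F i.right (k + 1) k u + chainMap F i.hom k q := by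
  refine (Represents.eq_zero_iff hc).trans ?_
  constructor
  · rintro ⟨u, hu⟩
    obtain ⟨u, rfl⟩ := relProj_surjective F i _ u
    rw [relProj_chainD, ← sub_eq_zero, ← map_sub, relProj_eq_zero_iff] at hu
    obtain ⟨q, hq⟩ := hu
    exact ⟨u, -q, by rw [map_neg, hq]; abel⟩
  · rintro ⟨u, q, rfl⟩
    refine ⟨relProj F i _ u, ?_⟩
    rw [relProj_chainD, map_add, (relProj_eq_zero_iff _).2 ⟨q, rfl⟩, add_zero]

lemma eq_iff [Mono i.hom] (hc : RelRepresents i k c h) (hc' : RelRepresents i k c' h') :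
    h = h' ↔ ∃ u q, c - c' = chainD F i.right (k + 1) k u + chainMap F i.hom k q := by
  rw [← sub_eq_zero, (hc.sub hc').eq_zero_iff]

lemma map (φ : i ⟶ j) (hc : RelRepresents i k c h) :
    RelRepresents j k (chainMap F φ.right k c) (((relHomology F k).map φ).hom h) := by
  have := Represents.map ((relChains F).map φ) hc
  have hφ : (pairSequence F i).g ≫ (relChains F).map φ =
      (singularChains F).map φ.right ≫ (pairSequence F j).g :=
    cokernel.π_desc _ _ _
  rwa [show (((relChains F).map φ).f k).hom (relProj F i k c) =
    relProj F j k (chainMap F φ.right k c) from congr((($hφ).f k).hom c)] at this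

end RelRepresents

end RelRepresents

/-! ### Ordered simplicial chains on a set of vertices, with augmentation -/

section OrderedChains

variable (F : Type v) [Field F] {V W : Type w}

/-- The formal linear combinations of `k`-tuples of points of `V`. -/
abbrev TupleChain (V : Type w) (k : ℕ) : Type (max v w) := (Fin k → V) →₀ F

/-- The cone with apex `b`. -/
def tupleCone (b : V) (k : ℕ) : TupleChain F V k →ₗ[F] TupleChain F V (k + 1) :=
  Finsupp.lmapDomain F F fun v => Fin.cons b v

/-- The simplicial boundary. -/
def tupleD (k : ℕ) : TupleChain F V (k + 1) →ₗ[F] TupleChain F V k :=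
  Finsupp.linearCombination F fun v => ∑ i : Fin (k + 1),
    (-1 : F) ^ i.val • Finsupp.single (v ∘ i.succAbove) 1

/-- The map induced by a map of the sets of vertices. -/
def tupleMap (f : V → W) (k : ℕ) : TupleChain F V k →ₗ[F] TupleChain F W k :=
  Finsupp.lmapDomain F F fun v => f ∘ v

variable {F}

lemma tupleCone_single (b : V) {k : ℕ} (v : Fin k → V) (a : F) :
    tupleCone F b k (Finsupp.single v a) =
      Finsupp.single (Fin.cons b v : Fin (k + 1) → V) a := by
  simp [tupleCone]

lemma tupleMap_single (f : V → W) {k : ℕ} (v : Fin k → V) (a : F) :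
    tupleMap F f k (Finsupp.single v a) = Finsupp.single (f ∘ v) a := by
  simp [tupleMap]

lemma tupleD_single {k : ℕ} (v : Fin (k + 1) → V) :
    tupleD F k (Finsupp.single v 1) = ∑ i : Fin (k + 1),
      (-1 : F) ^ i.val • Finsupp.single (v ∘ i.succAbove) 1 := by
  simp [tupleD]

lemma tupleChain_hom_ext {k : ℕ} {M : Type*} [AddCommGroup M] [Module F M]
    {f g : TupleChain F V k →ₗ[F] M}
    (h : ∀ v, f (Finsupp.single v 1) = g (Finsupp.single v 1)) : f = g :=
  Finsupp.lhom_ext' fun v => LinearMap.ext_ring (h v)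

/-- Chains on the empty tuple are the augmentation term: a k-simplex is a (k + 1)-tuple, so all
degrees are shifted by one. This is the bottom case of the cone formula. -/
lemma tupleD_tupleCone_zero (b : V) (c : TupleChain F V 0) :
    tupleD F 0 (tupleCone F b 0 c) = c := by
  suffices tupleD F 0 ∘ₗ tupleCone F b 0 = .id from congr($this c)
  refine tupleChain_hom_ext fun v => ?_
  simp only [LinearMap.comp_apply, tupleCone_single, tupleD_single]
  rw [Fin.sum_univ_one]
  simp

/-- Omitting the apex returns the tuple; omitting vertex i + 1 of the cone is the cone over omitting
vertex i, with the opposite sign. -/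
lemma tupleD_tupleCone (b : V) {k : ℕ} (c : TupleChain F V (k + 1)) :
    tupleD F (k + 1) (tupleCone F b (k + 1) c) = c - tupleCone F b k (tupleD F k c) := by
  suffices tupleD F (k + 1) ∘ₗ tupleCone F b (k + 1) =
    .id - tupleCone F b k ∘ₗ tupleD F k from congr($this c)
  refine tupleChain_hom_ext fun v => ?_
  simp only [LinearMap.comp_apply, LinearMap.sub_apply, LinearMap.id_apply, tupleCone_single,
    tupleD_single, map_sum, map_smul]
  rw [Fin.sum_univ_succ, sub_eq_add_neg, ← Finset.sum_neg_distrib]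
  congr 1
  · simp
  · refine Finset.sum_congr rfl fun i _ => ?_
    rw [Fin.val_succ, pow_succ, mul_neg_one, neg_smul]
    congr 3
    ext j
    refine Fin.cases ?_ (fun j => ?_) j <;> simp

/-- Every nonempty tuple is a cone b·v, and the cone formula gives DD(b·v) = Dv - D(b·Dv) = b·DDv,
which vanishes by induction. -/
lemma tupleD_tupleD {k : ℕ} (c : TupleChain F V (k + 2)) :
    tupleD F k (tupleD F (k + 1) c) = 0 := by
  suffices tupleD F k ∘ₗ tupleD F (k + 1) = (0 : TupleChain F V (k + 2) →ₗ[F] _) from congr($this c)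
  refine tupleChain_hom_ext fun v => ?_
  obtain ⟨b, v, rfl⟩ : ∃ b v', v = Fin.cons b v' := ⟨v 0, Fin.tail v, by simp⟩
  rw [← tupleCone_single]
  simp only [LinearMap.comp_apply, tupleD_tupleCone, map_sub, LinearMap.zero_apply]
  clear c
  induction k generalizing b with
  | zero => rw [tupleD_tupleCone_zero, sub_self]
  | succ k ih =>
    have : tupleD F k (tupleD F (k + 1) (Finsupp.single v 1)) = 0 := by
      obtain ⟨b, v, rfl⟩ : ∃ b v', v = Fin.cons b v' := ⟨v 0, Fin.tail v, by simp⟩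
      have := ih b v
      rwa [← map_sub, ← tupleD_tupleCone, tupleCone_single] at this
    rw [tupleD_tupleCone, this, map_zero, sub_zero, sub_self]

lemma tupleMap_tupleD (f : V → W) {k : ℕ} (c : TupleChain F V (k + 1)) :
    tupleMap F f k (tupleD F k c) = tupleD F k (tupleMap F f (k + 1) c) := by
  suffices tupleMap F f k ∘ₗ tupleD F k = tupleD F k ∘ₗ tupleMap F f (k + 1) from congr($this c)
  refine tupleChain_hom_ext fun v => ?_
  simp [tupleD_single, tupleMap_single, Function.comp_assoc]

lemma tupleMap_tupleCone (f : V → W) (b : V) {k : ℕ} (c : TupleChain F V k) :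
    tupleMap F f (k + 1) (tupleCone F b k c) = tupleCone F (f b) k (tupleMap F f k c) := by
  suffices tupleMap F f (k + 1) ∘ₗ tupleCone F b k = tupleCone F (f b) k ∘ₗ tupleMap F f k from
    congr($this c)
  refine tupleChain_hom_ext fun v => ?_
  simp only [LinearMap.comp_apply, tupleCone_single, tupleMap_single]
  congr 1
  ext j
  refine Fin.cases ?_ (fun j => ?_) j <;> simp

/-! ### Subdivision of ordered chains -/

variable (F) in
/-- The subdivision of ordered chains, for a choice `b` of a barycenter of each tuple. -/
def tupleSd (b : ∀ k, (Fin (k + 1) → V) → V) : ∀ k, TupleChain F V k →ₗ[F] TupleChain F V k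
  | 0 => .id
  | k + 1 => Finsupp.linearCombination F fun v =>
      tupleCone F (b k v) k (tupleSd b k (tupleD F k (Finsupp.single v 1)))

variable (F) in
/-- The chain homotopy between the subdivision and the identity. -/
def tupleT (b : ∀ k, (Fin (k + 1) → V) → V) :
    ∀ k, TupleChain F V k →ₗ[F] TupleChain F V (k + 1)
  | 0 => 0
  | k + 1 => Finsupp.linearCombination F fun v => tupleCone F (b k v) (k + 1)
      (Finsupp.single v 1 - tupleT b k (tupleD F k (Finsupp.single v 1)))

variable (b : ∀ k, (Fin (k + 1) → V) → V)

lemma tupleSd_single {k : ℕ} (v : Fin (k + 1) → V) :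
    tupleSd F b (k + 1) (Finsupp.single v 1) =
      tupleCone F (b k v) k (tupleSd F b k (tupleD F k (Finsupp.single v 1))) := by
  simp [tupleSd]

lemma tupleT_single {k : ℕ} (v : Fin (k + 1) → V) :
    tupleT F b (k + 1) (Finsupp.single v 1) = tupleCone F (b k v) (k + 1)
      (Finsupp.single v 1 - tupleT F b k (tupleD F k (Finsupp.single v 1))) := by
  simp [tupleT]

/-- By the cone formula, DTv = v - TDv - b·D(v - TDv). The inductive hypothesis applied to Dv,
together with DD = 0, turns D(v - TDv) into Sd(Dv), and b·Sd(Dv) is Sd v. -/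
lemma tupleD_tupleT {k : ℕ} (c : TupleChain F V (k + 1)) :
    tupleD F (k + 1) (tupleT F b (k + 1) c) + tupleT F b k (tupleD F k c) =
      c - tupleSd F b (k + 1) c := by
  suffices tupleD F (k + 1) ∘ₗ tupleT F b (k + 1) + tupleT F b k ∘ₗ tupleD F k =
    .id - tupleSd F b (k + 1) from congr($this c)
  clear c
  induction k with
  | zero =>
    refine tupleChain_hom_ext fun v => ?_
    simp only [LinearMap.comp_apply, LinearMap.sub_apply, LinearMap.id_apply, LinearMap.add_apply,
      tupleT_single, tupleSd_single, tupleD_tupleCone]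
    simp [tupleT, tupleSd]
  | succ k ih =>
    refine tupleChain_hom_ext fun v => ?_
    have h := congr($ih (tupleD F (k + 1) (Finsupp.single v 1)))
    simp only [LinearMap.comp_apply, LinearMap.sub_apply, LinearMap.id_apply, LinearMap.add_apply,
      tupleD_tupleD, map_zero, add_zero] at h
    simp only [LinearMap.comp_apply, LinearMap.sub_apply, LinearMap.id_apply, LinearMap.add_apply,
      tupleT_single, tupleSd_single, tupleD_tupleCone, map_sub, h]
    abel

variable {b} {b' : ∀ k, (Fin (k + 1) → W) → W} {f : V → W}

lemma tupleMap_tupleSd (hf : ∀ k v, f (b k v) = b' k (f ∘ v)) {k : ℕ} (c : TupleChain F V k) :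
    tupleMap F f k (tupleSd F b k c) = tupleSd F b' k (tupleMap F f k c) := by
  suffices tupleMap F f k ∘ₗ tupleSd F b k = tupleSd F b' k ∘ₗ tupleMap F f k from congr($this c)
  clear c
  induction k with
  | zero => rfl
  | succ k ih =>
    refine tupleChain_hom_ext fun v => ?_
    have h (c) := congr($ih c)
    simp only [LinearMap.comp_apply] at h
    simp only [LinearMap.comp_apply, tupleSd_single, tupleMap_single, tupleMap_tupleCone, h,
      tupleMap_tupleD, hf]

lemma tupleMap_tupleT (hf : ∀ k v, f (b k v) = b' k (f ∘ v)) {k : ℕ} (c : TupleChain F V k) :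
    tupleMap F f (k + 1) (tupleT F b k c) = tupleT F b' k (tupleMap F f k c) := by
  suffices tupleMap F f (k + 1) ∘ₗ tupleT F b k = tupleT F b' k ∘ₗ tupleMap F f k from congr($this c)
  clear c
  induction k with
  | zero => simp [tupleT]
  | succ k ih =>
    refine tupleChain_hom_ext fun v => ?_
    have h (c) := congr($ih c)
    simp only [LinearMap.comp_apply] at h
    simp only [LinearMap.comp_apply, tupleT_single, tupleMap_single, tupleMap_tupleCone, map_sub, h,
      tupleMap_tupleD, hf]

end OrderedChains

/-! ### Affine singular simplices -/

section Affine

variable {k l n : ℕ}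

/-- The affine map of simplices with given values on the vertices. -/
def affineSimplex (v : Fin (k + 1) → Simplex n) : C(Simplex k, Simplex n) where
  toFun t := ⟨∑ i, t i • (v i).1,
    (convex_stdSimplex ℝ (Fin (n + 1))).sum_mem (fun i _ => stdSimplex.zero_le t i)
      (stdSimplex.sum_eq_one t) fun i _ => (v i).2⟩
  continuous_toFun := by
    refine Continuous.subtype_mk (continuous_finsetSum _ fun i _ => ?_) _
    exact ((continuous_apply i).comp continuous_subtype_val).smul continuous_const

lemma coe_affineSimplex (v : Fin (k + 1) → Simplex n) (t : Simplex k) :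
    (affineSimplex v t).1 = ∑ i, t i • (v i).1 := rfl

lemma affineSimplex_vertex (v : Fin (k + 1) → Simplex n) (i : Fin (k + 1)) :
    affineSimplex v (stdSimplex.vertex i) = v i := by
  apply Subtype.ext
  rw [coe_affineSimplex, Finset.sum_eq_single i]
  · simp
  · intro j _ hj
    simp [hj]
  · simp

lemma affineSimplex_comp (v : Fin (k + 1) → Simplex n) (w : Fin (l + 1) → Simplex k) :
    (affineSimplex v).comp (affineSimplex w) = affineSimplex (affineSimplex v ∘ w) := by
  ext t : 1
  apply Subtype.ext
  simp only [ContinuousMap.comp_apply, coe_affineSimplex, Function.comp_apply, Finset.smul_sum]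
  rw [Finset.sum_comm]
  refine Finset.sum_congr rfl fun i _ => ?_
  have : affineSimplex w t i = ∑ j, t j * w j i := by
    refine (congrFun (coe_affineSimplex w t) i).trans ?_
    simp
    rfl
  rw [this, Finset.sum_smul]
  exact Finset.sum_congr rfl fun j _ => by rw [smul_smul]

lemma simplexMap_eq_affineSimplex (f : Fin (k + 1) → Fin (n + 1)) :
    simplexMap f = affineSimplex fun i => stdSimplex.vertex (f i) := by
  ext t : 1
  apply Subtype.ext
  ext j
  have h : (simplexMap f t).1 j = FunOnFinite.linearMap ℝ ℝ f t j := rfl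
  rw [h, FunOnFinite.linearMap_apply_apply, coe_affineSimplex, Finset.sum_apply,
    Finset.sum_filter]
  refine Finset.sum_congr rfl fun i _ => ?_
  simp [Pi.single_apply, eq_comm]

lemma affineSimplex_comp_simplexMap (v : Fin (k + 1) → Simplex n) (f : Fin (l + 1) → Fin (k + 1)) :
    (affineSimplex v).comp (simplexMap f) = affineSimplex (v ∘ f) := by
  rw [simplexMap_eq_affineSimplex, affineSimplex_comp]
  congr 1
  ext i : 1
  exact affineSimplex_vertex v (f i)

lemma affineSimplex_vertices : affineSimplex (stdSimplex.vertex (S := ℝ)) = .id (Simplex n) := by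
  ext t : 1
  apply Subtype.ext
  rw [coe_affineSimplex]
  ext j
  simp [Pi.single_apply]
  rfl

/-- The barycenter of an affine simplex. -/
def bary (k : ℕ) (v : Fin (k + 1) → Simplex n) : Simplex n :=
  affineSimplex v stdSimplex.barycenter

/-- Affine maps preserve barycenters; this is the compatibility under which the subdivision and its
homotopy are natural. -/
lemma affineSimplex_bary (v : Fin (k + 1) → Simplex n) (l : ℕ) (w : Fin (l + 1) → Simplex k) :
    affineSimplex v (bary l w) = bary l (affineSimplex v ∘ w) :=
  congr($(affineSimplex_comp v w) stdSimplex.barycenter)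

lemma dist_affineSimplex_le (v : Fin (k + 1) → Simplex n) (p : Simplex n) {d : ℝ}
    (h : ∀ i, dist (v i) p ≤ d) (t : Simplex k) : dist (affineSimplex v t) p ≤ d :=
  (convex_closedBall p.1 d).sum_mem (fun i _ => stdSimplex.zero_le t i)
      (stdSimplex.sum_eq_one t) fun i _ => h i

/-- The difference of the barycenter and v j is the average of the k + 1 vectors v i - v j, one of
which is zero; this is the source of the contraction factor k / (k + 1). -/
lemma dist_bary_le (v : Fin (k + 1) → Simplex n) {d : ℝ} (h : ∀ i j, dist (v i) (v j) ≤ d)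
    (j : Fin (k + 1)) : dist (bary k v) (v j) ≤ k / (k + 1) * d := by
  have hk : (k + 1 : ℝ) ≠ 0 := by positivity
  have hb : (bary k v).1 - (v j).1 =
      ∑ i, (k + 1 : ℝ)⁻¹ • ((v i).1 - (v j).1) := by
    rw [← Finset.smul_sum, Finset.sum_sub_distrib, Finset.sum_const, Finset.card_univ,
      Fintype.card_fin, smul_sub, ← Nat.cast_smul_eq_nsmul ℝ, smul_smul, Nat.cast_succ,
      inv_mul_cancel₀ hk, one_smul, bary, coe_affineSimplex, Finset.smul_sum]
    congr 1
    refine Finset.sum_congr rfl fun i _ => ?_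
    congr 1
    refine (stdSimplex.barycenter_apply i).trans ?_
    simp
  rw [Subtype.dist_eq, dist_eq_norm, hb]
  refine (norm_sum_le _ _).trans ?_
  rw [← Finset.add_sum_erase _ _ (Finset.mem_univ j), sub_self, smul_zero, norm_zero, zero_add]
  refine (Finset.sum_le_card_nsmul _ _ ((k + 1 : ℝ)⁻¹ * d) fun i _ => ?_).trans ?_
  · rw [norm_smul, Real.norm_of_nonneg (by positivity), ← dist_eq_norm, ← Subtype.dist_eq]
    exact mul_le_mul_of_nonneg_left (h i j) (by positivity)
  · rw [Finset.card_erase_of_mem (Finset.mem_univ j), Finset.card_univ, Fintype.card_fin,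
      nsmul_eq_mul, Nat.add_sub_cancel]
    apply le_of_eq
    field_simp

/-! ### The mesh of the subdivision -/

/-- The tuples of points of the convex hull of `S` whose mutual distances are at most `d`. -/
def smallTuples (S : Set (Fin (n + 1) → ℝ)) (d : ℝ) (k : ℕ) : Set (Fin k → Simplex n) :=
  {w | (∀ i, (w i).1 ∈ convexHull ℝ S) ∧ ∀ i j, dist (w i) (w j) ≤ d}

variable (F : Type v) [Field F]

/-- The convex hull is carried through the induction because the new apex has to be close to the
vertices of the subdivided faces, and these are only known to be convex combinations of the original
vertices. The bound N is fixed so that one factor serves all dimensions of faces. -/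
lemma tupleSd_mem_supported {N : ℕ} {k : ℕ} (hk : k ≤ N + 1) (v : Fin k → Simplex n) {d : ℝ}
    (hd : 0 ≤ d) (h : ∀ i j, dist (v i) (v j) ≤ d) :
    tupleSd F bary k (Finsupp.single v 1) ∈ Finsupp.supported F F
      (smallTuples (Set.range fun i => (v i).1) (N / (N + 1) * d) k) := by
  induction k with
  | zero => exact Finsupp.single_mem_supported F _ ⟨fun i => i.elim0, fun i => i.elim0⟩
  | succ k ih =>
    rw [tupleSd_single, tupleD_single, map_sum, map_sum]
    refine Submodule.sum_mem _ fun i _ => ?_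
    rw [map_smul, map_smul]
    refine Submodule.smul_mem _ _ ?_
    have := ih (by omega) (v ∘ i.succAbove) fun a b => h _ _
    rw [Finsupp.supported_eq_span_single] at this
    generalize tupleSd F bary k (Finsupp.single (v ∘ i.succAbove) 1) = c at this
    induction this using Submodule.span_induction with
    | zero => simp
    | add x y _ _ hx hy => rw [map_add]; exact add_mem hx hy
    | smul a x _ hx => rw [map_smul]; exact Submodule.smul_mem _ _ hx
    | mem x hx =>
      obtain ⟨w, ⟨hw, hw'⟩, rfl⟩ := hx
      rw [tupleCone_single]
      refine Finsupp.single_mem_supported F _ ?_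
      have hsub : (Set.range fun j => ((v ∘ i.succAbove) j).1) ⊆
          Set.range fun j => (v j).1 := by
        rintro _ ⟨j, rfl⟩
        exact ⟨i.succAbove j, rfl⟩
      have hwv (j) := convexHull_mono hsub (hw j)
      have hle : (k / (k + 1) : ℝ) ≤ N / (N + 1) := by
        have : (k : ℝ) ≤ N := by exact_mod_cast (by omega : k ≤ N)
        rw [div_le_div_iff₀ (by positivity) (by positivity)]
        nlinarith
      have hb (j) : dist (bary k v) (w j) ≤ N / (N + 1) * d := by
        refine le_trans ?_ (mul_le_mul_of_nonneg_right hle hd)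
        rw [dist_comm]
        -- The ball around the barycenter contains all v a and is convex, so it contains their hull
        -- and with it w j.
        refine (convexHull_min ?_ (convex_closedBall (bary k v).1
          (k / (k + 1) * d))) (hwv j)
        rintro _ ⟨a, rfl⟩
        rw [Metric.mem_closedBall, dist_comm]
        exact dist_bary_le v h a
      have hbv : (bary k v).1 ∈
          convexHull ℝ (Set.range fun j => (v j).1) :=
        (convex_convexHull ℝ _).sum_mem (fun i _ => stdSimplex.zero_le stdSimplex.barycenter i)
          (stdSimplex.sum_eq_one stdSimplex.barycenter)
          fun i _ => subset_convexHull ℝ _ (Set.mem_range_self i)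
      have hnn : 0 ≤ N / (N + 1) * d := by positivity
      refine ⟨fun j => ?_, fun a b => ?_⟩
      · refine Fin.cases ?_ (fun j => ?_) j
        · simpa using hbv
        · simpa using hwv j
      · refine Fin.cases ?_ (fun a => ?_) a <;> refine Fin.cases ?_ (fun b => ?_) b
        · simpa using hnn
        · simpa using hb b
        · simpa [dist_comm] using hb a
        · simpa using hw' a b

variable (n) in
/-- The ordered chains all of whose tuples have mutual distances at most `d`. -/
def meshSubmodule (d : ℝ) (k : ℕ) : Submodule F (TupleChain F (Simplex n) k) :=
  Finsupp.supported F F {w | ∀ i j, dist (w i) (w j) ≤ d}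

variable {F}

lemma tupleSd_mem_meshSubmodule {N : ℕ} (hk : k ≤ N + 1) {d : ℝ} (hd : 0 ≤ d)
    {c : TupleChain F (Simplex n) k} (hc : c ∈ meshSubmodule n F d k) :
    tupleSd F bary k c ∈ meshSubmodule n F (N / (N + 1) * d) k := by
  rw [meshSubmodule, Finsupp.supported_eq_span_single] at hc
  induction hc using Submodule.span_induction with
  | zero => simp
  | add x y _ _ hx hy => rw [map_add]; exact add_mem hx hy
  | smul a x _ hx => rw [map_smul]; exact Submodule.smul_mem _ _ hx
  | mem x hx =>
    obtain ⟨v, hv, rfl⟩ := hx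
    exact Finsupp.supported_mono (fun w hw => hw.2) (tupleSd_mem_supported F hk v hd hv)

lemma tupleSd_iterate_mem_meshSubmodule {N : ℕ} (hk : k ≤ N + 1) {d : ℝ} (hd : 0 ≤ d)
    {c : TupleChain F (Simplex n) k} (hc : c ∈ meshSubmodule n F d k) (m : ℕ) :
    (tupleSd F bary k)^[m] c ∈ meshSubmodule n F ((N / (N + 1)) ^ m * d) k := by
  induction m with
  | zero => simpa using hc
  | succ m ih =>
    rw [Function.iterate_succ_apply', pow_succ', mul_assoc]
    exact tupleSd_mem_meshSubmodule hk (by positivity) ih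

lemma exists_iterate_mem_meshSubmodule (c : TupleChain F (Simplex n) k) {ε : ℝ} (hε : 0 < ε) :
    ∃ m, (tupleSd F bary k)^[m] c ∈ meshSubmodule n F ε k := by
  -- In the maximum metric the standard simplex has diameter at most 1, so every chain starts with
  -- mesh 1.
  have hc : c ∈ meshSubmodule n F 1 k := by
    refine fun w _ i j => ?_
    exact (Metric.dist_le_diam_of_mem (bounded_stdSimplex _) (w i).2 (w j).2).trans
      diam_stdSimplex_le
  have hlt : (k / (k + 1) : ℝ) < 1 := by
    rw [div_lt_one (by positivity)]
    linarith
  obtain ⟨m, hm⟩ := exists_pow_lt_of_lt_one hε hlt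
  refine ⟨m, Finsupp.supported_mono (fun w hw i j => (hw i j).trans ?_)
    (tupleSd_iterate_mem_meshSubmodule (N := k) (by omega) zero_le_one hc m)⟩
  rw [mul_one]
  exact hm.le

end Affine

/-! ### Subdivision of singular chains -/

section Subdivision

variable {F : Type v} [Field F] {X Y : TopCat.{u}} {k n : ℕ}

lemma singularChains_linearMap_ext {M : Type*} [AddCommGroup M] [Module F M]
    {f g : ((singularChains.{u, v} F).obj X).X n →ₗ[F] M}
    (h : ∀ σ : C(Simplex n, X), f (singularSimplex σ) = g (singularSimplex σ)) : f = g :=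
  (singularBasis F X n).ext fun σ => by simpa using h σ

variable (F) in
/-- The singular chains of `X` given by affine simplices in the domain of a singular simplex. -/
def realize (σ : C(Simplex n, X)) (k : ℕ) :
    TupleChain F (Simplex n) (k + 1) →ₗ[F] ((singularChains.{u, v} F).obj X).X k :=
  Finsupp.linearCombination F fun v => singularSimplex (σ.comp (affineSimplex v))

lemma realize_single (σ : C(Simplex n, X)) (v : Fin (k + 1) → Simplex n) :
    realize F σ k (Finsupp.single v 1) = singularSimplex (σ.comp (affineSimplex v)) := by
  simp [realize]

lemma chainMap_singularSimplex (f : X ⟶ Y) (σ : C(Simplex n, X)) :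
    chainMap F f n (singularSimplex σ) = singularSimplex (f.hom.comp σ) :=
  singularChains_map_singularSimplex F f σ

lemma chainD_singularSimplex (σ : C(Simplex (n + 1), X)) :
    chainD F X (n + 1) n (singularSimplex σ) =
      ∑ i : Fin (n + 2), (-1 : F) ^ i.val • singularSimplex (σ.comp (simplexMap i.succAbove)) :=
  singularChains_d_singularSimplex F σ

lemma chainMap_realize (f : X ⟶ Y) (σ : C(Simplex n, X)) (c : TupleChain F (Simplex n) (k + 1)) :
    chainMap F f k (realize F σ k c) = realize F (f.hom.comp σ) k c := by
  suffices chainMap F f k ∘ₗ realize F σ k = realize F (f.hom.comp σ) k from congr($this c)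
  refine tupleChain_hom_ext fun v => ?_
  simp only [LinearMap.comp_apply, realize_single, chainMap_singularSimplex]
  rfl

lemma chainD_realize (σ : C(Simplex n, X)) (c : TupleChain F (Simplex n) (k + 2)) :
    chainD F X (k + 1) k (realize F σ (k + 1) c) = realize F σ k (tupleD F (k + 1) c) := by
  suffices chainD F X (k + 1) k ∘ₗ realize F σ (k + 1) = realize F σ k ∘ₗ tupleD F (k + 1) from
    congr($this c)
  refine tupleChain_hom_ext fun v => ?_
  simp only [LinearMap.comp_apply, realize_single, chainD_singularSimplex, tupleD_single, map_sum,
    map_smul]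
  refine Finset.sum_congr rfl fun i _ => ?_
  rw [ContinuousMap.comp_assoc, affineSimplex_comp_simplexMap]

lemma realize_comp (σ : C(Simplex n, X)) {l : ℕ} (u : Fin (l + 1) → Simplex n)
    (c : TupleChain F (Simplex l) (k + 1)) :
    realize F (σ.comp (affineSimplex u)) k c =
      realize F σ k (tupleMap F (affineSimplex u) (k + 1) c) := by
  suffices realize F (σ.comp (affineSimplex u)) k =
    realize F σ k ∘ₗ tupleMap F (affineSimplex u) (k + 1) from congr($this c)
  refine tupleChain_hom_ext fun v => ?_
  simp only [LinearMap.comp_apply, realize_single, tupleMap_single]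
  rw [ContinuousMap.comp_assoc, affineSimplex_comp]

variable (F) in
/-- The tuple of the vertices of the simplex. -/
def vertices (n : ℕ) : TupleChain F (Simplex n) (n + 1) :=
  Finsupp.single (stdSimplex.vertex (S := ℝ)) 1

lemma tupleMap_vertices {l : ℕ} (u : Fin (l + 1) → Simplex n) :
    tupleMap F (affineSimplex u) (l + 1) (vertices F l) = Finsupp.single u 1 := by
  rw [vertices, tupleMap_single]
  congr 1
  ext i : 1
  exact affineSimplex_vertex u i

lemma realize_vertices (σ : C(Simplex n, X)) :
    realize F σ n (vertices F n) = singularSimplex σ := by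
  rw [vertices, realize_single, affineSimplex_vertices, ContinuousMap.comp_id]

variable (F X) in
/-- The barycentric subdivision of singular chains. -/
def singularSd (k : ℕ) :
    ((singularChains.{u, v} F).obj X).X k →ₗ[F] ((singularChains.{u, v} F).obj X).X k :=
  (singularBasis F X k).constr F fun σ => realize F σ k (tupleSd F bary (k + 1) (vertices F k))

variable (F X) in
/-- The chain homotopy between the subdivision and the identity. -/
def singularT (k : ℕ) :
    ((singularChains.{u, v} F).obj X).X k →ₗ[F] ((singularChains.{u, v} F).obj X).X (k + 1) :=
  (singularBasis F X k).constr F fun σ =>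
    realize F σ (k + 1) (tupleT F bary (k + 1) (vertices F k))

lemma singularSd_singularSimplex (σ : C(Simplex k, X)) :
    singularSd F X k (singularSimplex σ) =
      realize F σ k (tupleSd F bary (k + 1) (vertices F k)) := by
  rw [← singularBasis_apply, singularSd, Module.Basis.constr_basis]

lemma singularT_singularSimplex (σ : C(Simplex k, X)) :
    singularT F X k (singularSimplex σ) =
      realize F σ (k + 1) (tupleT F bary (k + 1) (vertices F k)) := by
  rw [← singularBasis_apply, singularT, Module.Basis.constr_basis]

/-- By naturality of the subdivision under affine maps, subdividing a realized chain is the same as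
subdividing in the domain. This transfers identities between ordered chains to singular chains. -/
lemma singularSd_realize (σ : C(Simplex n, X)) (c : TupleChain F (Simplex n) (k + 1)) :
    singularSd F X k (realize F σ k c) = realize F σ k (tupleSd F bary (k + 1) c) := by
  suffices singularSd F X k ∘ₗ realize F σ k = realize F σ k ∘ₗ tupleSd F bary (k + 1) from
    congr($this c)
  refine tupleChain_hom_ext fun v => ?_
  simp only [LinearMap.comp_apply, realize_single, singularSd_singularSimplex, realize_comp]
  rw [tupleMap_tupleSd (fun l w => affineSimplex_bary v l w), tupleMap_vertices]

lemma singularT_realize (σ : C(Simplex n, X)) (c : TupleChain F (Simplex n) (k + 1)) :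
    singularT F X k (realize F σ k c) = realize F σ (k + 1) (tupleT F bary (k + 1) c) := by
  suffices singularT F X k ∘ₗ realize F σ k = realize F σ (k + 1) ∘ₗ tupleT F bary (k + 1) from
    congr($this c)
  refine tupleChain_hom_ext fun v => ?_
  simp only [LinearMap.comp_apply, realize_single, singularT_singularSimplex, realize_comp]
  rw [tupleMap_tupleT (fun l w => affineSimplex_bary v l w), tupleMap_vertices]

lemma chainD_singularT_succ (c : ((singularChains.{u, v} F).obj X).X (k + 1)) :
    chainD F X (k + 2) (k + 1) (singularT F X (k + 1) c) +
      singularT F X k (chainD F X (k + 1) k c) = c - singularSd F X (k + 1) c := by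
  suffices chainD F X (k + 2) (k + 1) ∘ₗ singularT F X (k + 1) +
      singularT F X k ∘ₗ chainD F X (k + 1) k = .id - singularSd F X (k + 1) from congr($this c)
  refine singularChains_linearMap_ext fun σ => ?_
  simp only [LinearMap.comp_apply, LinearMap.add_apply, LinearMap.sub_apply, LinearMap.id_apply]
  rw [← realize_vertices σ]
  simp only [singularT_realize, chainD_realize, singularSd_realize]
  rw [← map_add, tupleD_tupleT, map_sub]

lemma chainD_singularT_zero (c : ((singularChains.{u, v} F).obj X).X 0) :
    chainD F X 1 0 (singularT F X 0 c) = c - singularSd F X 0 c := by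
  suffices chainD F X 1 0 ∘ₗ singularT F X 0 = .id - singularSd F X 0 from congr($this c)
  refine singularChains_linearMap_ext fun σ => ?_
  simp only [LinearMap.comp_apply, LinearMap.sub_apply, LinearMap.id_apply]
  rw [← realize_vertices σ]
  simp only [singularT_realize, chainD_realize, singularSd_realize]
  have := tupleD_tupleT bary (vertices F 0)
  -- Ordered chains are augmented and singular chains are not; the extra term lives on the empty
  -- tuple, where the homotopy is zero by definition.
  rw [show tupleT F bary 0 (tupleD F 0 (vertices F 0)) = 0 from rfl, add_zero] at this
  rw [this, map_sub]

lemma chainMap_singularSd (f : X ⟶ Y) (c : ((singularChains.{u, v} F).obj X).X k) :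
    chainMap F f k (singularSd F X k c) = singularSd F Y k (chainMap F f k c) := by
  suffices chainMap F f k ∘ₗ singularSd F X k = singularSd F Y k ∘ₗ chainMap F f k from
    congr($this c)
  refine singularChains_linearMap_ext fun σ => ?_
  simp only [LinearMap.comp_apply, singularSd_singularSimplex, chainMap_realize,
    chainMap_singularSimplex]

lemma chainMap_singularT (f : X ⟶ Y) (c : ((singularChains.{u, v} F).obj X).X k) :
    chainMap F f (k + 1) (singularT F X k c) = singularT F Y k (chainMap F f k c) := by
  suffices chainMap F f (k + 1) ∘ₗ singularT F X k = singularT F Y k ∘ₗ chainMap F f k from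
    congr($this c)
  refine singularChains_linearMap_ext fun σ => ?_
  simp only [LinearMap.comp_apply, singularT_singularSimplex, chainMap_realize,
    chainMap_singularSimplex]

/-- Applying D to the homotopy formula, and the homotopy formula to Dc, gives two expressions for
DTDc. No further induction is needed. -/
lemma chainD_singularSd (c : ((singularChains.{u, v} F).obj X).X (k + 1)) :
    chainD F X (k + 1) k (singularSd F X (k + 1) c) =
      singularSd F X k (chainD F X (k + 1) k c) := by
  have h := congrArg (chainD F X (k + 1) k) (chainD_singularT_succ c)
  rw [map_add, chainD_chainD, zero_add, map_sub] at h
  have h' : chainD F X (k + 1) k (singularT F X k (chainD F X (k + 1) k c)) =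
      chainD F X (k + 1) k c - singularSd F X k (chainD F X (k + 1) k c) := by
    cases k with
    | zero => rw [chainD_singularT_zero]
    | succ k =>
      rw [← chainD_singularT_succ, chainD_chainD, map_zero, add_zero]
  exact sub_right_injective (h.symm.trans h')

/-! ### Small chains -/

variable (F) in
/-- The chains spanned by the simplices that lie in one of the sets of `𝒰`. -/
def smallChains (𝒰 : Set (Set X)) (k : ℕ) : Submodule F (((singularChains.{u, v} F).obj X).X k) :=
  Submodule.span F {c | ∃ σ : C(Simplex k, X), (∃ U ∈ 𝒰, Set.range σ ⊆ U) ∧ c = singularSimplex σ}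

lemma singularSd_mem_smallChains {𝒰 : Set (Set X)}
    {c : ((singularChains.{u, v} F).obj X).X k} (hc : c ∈ smallChains F 𝒰 k) :
    singularSd F X k c ∈ smallChains F 𝒰 k := by
  induction hc using Submodule.span_induction with
  | zero => simp
  | add x y _ _ hx hy => rw [map_add]; exact add_mem hx hy
  | smul a x _ hx => rw [map_smul]; exact Submodule.smul_mem _ _ hx
  | mem x hx =>
    obtain ⟨σ, ⟨U, hU, hσ⟩, rfl⟩ := hx
    rw [singularSd_singularSimplex, realize, Finsupp.linearCombination_apply]
    refine Submodule.sum_mem _ fun v _ => Submodule.smul_mem _ _ (Submodule.subset_span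
      ⟨_, ⟨U, hU, ?_⟩, rfl⟩)
    rintro _ ⟨t, rfl⟩
    exact hσ ⟨_, rfl⟩

lemma singularSd_iterate_mem_smallChains {𝒰 : Set (Set X)}
    {c : ((singularChains.{u, v} F).obj X).X k} (hc : c ∈ smallChains F 𝒰 k) (m : ℕ) :
    (singularSd F X k)^[m] c ∈ smallChains F 𝒰 k := by
  induction m with
  | zero => exact hc
  | succ m ih =>
    rw [Function.iterate_succ_apply']
    exact singularSd_mem_smallChains ih

lemma singularSd_iterate_realize (σ : C(Simplex n, X)) (c : TupleChain F (Simplex n) (k + 1))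
    (m : ℕ) : (singularSd F X k)^[m] (realize F σ k c) =
      realize F σ k ((tupleSd F bary (k + 1))^[m] c) := by
  induction m with
  | zero => rfl
  | succ m ih => rw [Function.iterate_succ_apply', Function.iterate_succ_apply', ih,
      singularSd_realize]

/-- Take a Lebesgue number ε of the cover pulled back to the compact simplex. Once the mesh is at
most ε / 2, each affine piece lies in the ε-ball around its vertex 0, hence in one set of the cover.
-/
lemma exists_iterate_singularSimplex_mem_smallChains {𝒰 : Set (Set X)}
    (h𝒰 : ⋃ U ∈ 𝒰, interior U = Set.univ) (σ : C(Simplex k, X)) :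
    ∃ m, (singularSd F X k)^[m] (singularSimplex σ) ∈ smallChains F 𝒰 k := by
  obtain ⟨ε, hε, h⟩ := lebesgue_number_lemma_of_metric_sUnion (s := (Set.univ : Set (Simplex k)))
    (c := {V | ∃ U ∈ 𝒰, V = σ ⁻¹' interior U}) isCompact_univ
    (by rintro _ ⟨U, -, rfl⟩; exact isOpen_interior.preimage σ.continuous)
    (fun t _ => by
      have : σ t ∈ ⋃ U ∈ 𝒰, interior U := h𝒰 ▸ Set.mem_univ _
      simp only [Set.mem_iUnion] at this
      obtain ⟨U, hU, ht⟩ := this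
      exact ⟨_, ⟨U, hU, rfl⟩, ht⟩)
  obtain ⟨m, hm⟩ := exists_iterate_mem_meshSubmodule (F := F) (vertices F k) (half_pos hε)
  refine ⟨m, ?_⟩
  rw [← realize_vertices σ, singularSd_iterate_realize, realize, Finsupp.linearCombination_apply]
  refine Submodule.sum_mem _ fun v hv => Submodule.smul_mem _ _ (Submodule.subset_span ?_)
  have hv' := hm hv
  obtain ⟨_, ⟨U, hU, rfl⟩, hb⟩ := h (v 0) (Set.mem_univ _)
  refine ⟨_, ⟨U, hU, ?_⟩, rfl⟩
  rintro _ ⟨t, rfl⟩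
  refine interior_subset (hb ?_)
  exact (dist_affineSimplex_le v (v 0) (fun i => hv' i 0) t).trans_lt (half_lt_self hε)

/-- Iterated subdivision makes every chain small. -/
lemma exists_iterate_mem_smallChains {𝒰 : Set (Set X)}
    (h𝒰 : ⋃ U ∈ 𝒰, interior U = Set.univ) (c : ((singularChains.{u, v} F).obj X).X k) :
    ∃ m₀, ∀ m, m₀ ≤ m → (singularSd F X k)^[m] c ∈ smallChains F 𝒰 k := by
  have hc := (singularBasis F X k).mem_span c
  induction hc using Submodule.span_induction with
  | zero =>
    refine ⟨0, fun m _ => ?_⟩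
    rw [← Module.End.pow_apply, map_zero]
    exact zero_mem _
  | add x y _ _ hx hy =>
    obtain ⟨m₁, h₁⟩ := hx
    obtain ⟨m₂, h₂⟩ := hy
    refine ⟨max m₁ m₂, fun m hm => ?_⟩
    have h₁ := h₁ m (by omega)
    have h₂ := h₂ m (by omega)
    rw [← Module.End.pow_apply] at h₁ h₂ ⊢
    rw [map_add]
    exact add_mem h₁ h₂
  | smul a x _ hx =>
    obtain ⟨m₁, h₁⟩ := hx
    refine ⟨m₁, fun m hm => ?_⟩
    have h₁ := h₁ m hm
    rw [← Module.End.pow_apply] at h₁ ⊢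
    rw [map_smul]
    exact Submodule.smul_mem _ _ h₁
  | mem x hx =>
    obtain ⟨σ, rfl⟩ := hx
    rw [singularBasis_apply]
    obtain ⟨m₀, h⟩ := exists_iterate_singularSimplex_mem_smallChains (F := F) h𝒰 σ
    refine ⟨m₀, fun m hm => ?_⟩
    obtain ⟨l, rfl⟩ := Nat.exists_eq_add_of_le' hm
    rw [Function.iterate_add_apply]
    exact singularSd_iterate_mem_smallChains h l

end Subdivision

/-! ### Excision -/

section Excision

variable {F : Type v} [Field F] {X Y : TopCat.{u}} {k : ℕ} {i j : Arrow TopCat.{u}}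

lemma singularSimplex_mem_range_chainMap {f : X ⟶ Y} (hf : Topology.IsEmbedding f.hom)
    {σ : C(Simplex k, Y)} (hσ : Set.range σ ⊆ Set.range f.hom) :
    (singularSimplex σ : ((singularChains.{u, v} F).obj Y).X k) ∈
      LinearMap.range (chainMap F f k) := by
  choose g hg using fun t => hσ ⟨t, rfl⟩
  refine ⟨singularSimplex ⟨g, hf.continuous_iff.2 (by convert σ.continuous; exact funext hg)⟩, ?_⟩
  rw [chainMap_singularSimplex]
  congr 1
  ext t
  exact hg t

/-- A chain comes from a subspace exactly if each singular simplex in its basis expansion does;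
intersections of chain groups can thus be read off from supports. -/
lemma mem_range_chainMap_iff {f : X ⟶ Y} (hf : Topology.IsEmbedding f.hom)
    (c : ((singularChains.{u, v} F).obj Y).X k) :
    c ∈ LinearMap.range (chainMap F f k) ↔
      ∀ σ ∈ ((singularBasis F Y k).repr c).support, Set.range σ ⊆ Set.range f.hom := by
  constructor
  · rintro ⟨a, rfl⟩
    have : (singularBasis F Y k).repr (chainMap F f k a) ∈
        Finsupp.supported F F {σ : C(Simplex k, Y) | Set.range σ ⊆ Set.range f.hom} := by
      have ha := (singularBasis F X k).mem_span a
      induction ha using Submodule.span_induction with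
      | zero => simp
      | add x y _ _ hx hy => rw [map_add, map_add]; exact add_mem hx hy
      | smul a x _ hx => rw [map_smul, map_smul]; exact Submodule.smul_mem _ _ hx
      | mem x hx =>
        obtain ⟨σ, rfl⟩ := hx
        rw [singularBasis_apply, chainMap_singularSimplex, ← singularBasis_apply,
          Module.Basis.repr_self]
        refine Finsupp.single_mem_supported F _ ?_
        rintro _ ⟨t, rfl⟩
        exact ⟨_, rfl⟩
    exact fun σ hσ => this hσ
  · intro h
    rw [← (singularBasis F Y k).linearCombination_repr c, Finsupp.linearCombination_apply]
    refine Submodule.sum_mem _ fun σ hσ => Submodule.smul_mem _ _ ?_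
    rw [singularBasis_apply]
    exact singularSimplex_mem_range_chainMap hf (h σ hσ)

lemma singularSd_iterate_chainMap (f : X ⟶ Y) (m : ℕ) (c : ((singularChains.{u, v} F).obj X).X k) :
    chainMap F f k ((singularSd F X k)^[m] c) = (singularSd F Y k)^[m] (chainMap F f k c) :=
  Function.Semiconj.iterate_right (f := chainMap F f k) (fun c => chainMap_singularSd f c) m c

lemma singularSd_iterate_chainD (m : ℕ) (c : ((singularChains.{u, v} F).obj X).X (k + 1)) :
    chainD F X (k + 1) k ((singularSd F X (k + 1))^[m] c) =
      (singularSd F X k)^[m] (chainD F X (k + 1) k c) :=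
  Function.Semiconj.iterate_right (f := chainD F X (k + 1) k) (fun c => chainD_singularSd c) m c

namespace RelRepresents

variable [Mono i.hom] {c c' : ((singularChains.{u, v} F).obj i.right).X k}
  {h : (relHomology F k).obj i}

lemma congr (hc : RelRepresents i k c h) {u : ((singularChains.{u, v} F).obj i.right).X (k + 1)}
    {q : ((singularChains.{u, v} F).obj i.left).X k}
    (huq : c - c' = chainD F i.right (k + 1) k u + chainMap F i.hom k q) :
    RelRepresents i k c' h := by
  have hc' : c' = c - (chainD F i.right (k + 1) k u + chainMap F i.hom k q) := by
    rw [← huq, sub_sub_cancel]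
  obtain ⟨h', hh'⟩ := exists_relRepresents_of_cycle (i := i) (c := c') fun l => by
    obtain ⟨q', hq'⟩ := hc.exists_chainD_eq l
    refine ⟨q' - chainD F i.left k l q, ?_⟩
    rw [hc', map_sub, map_sub, map_add, chainD_chainD, zero_add, hq', chainMap_chainD]
  rwa [(hc.eq_iff hh').2 ⟨u, q, huq⟩]

/-- One has c - Sd c = DTc + TDc. Since Dc comes from the subspace and T is natural, TDc comes from
the subspace too, so the relative class does not change. -/
lemma singularSd_iterate (hc : RelRepresents i k c h) (m : ℕ) :
    RelRepresents i k ((singularSd F i.right k)^[m] c) h := by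
  induction m with
  | zero => exact hc
  | succ m ih =>
    rw [Function.iterate_succ_apply']
    generalize (singularSd F i.right k)^[m] c = c at ih
    cases k with
    | zero =>
      refine ih.congr (u := singularT F i.right 0 c) (q := 0) ?_
      rw [chainD_singularT_zero, map_zero, add_zero]
    | succ k =>
      obtain ⟨q, hq⟩ := ih.exists_chainD_eq k
      refine ih.congr (u := singularT F i.right (k + 1) c) (q := singularT F i.left k q) ?_
      rw [chainMap_singularT, hq, chainD_singularT_succ]

end RelRepresents

lemma exists_eq_add_of_mem_smallChains {φ : i ⟶ j} (hφ : Topology.IsEmbedding φ.right.hom)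
    (hj : Topology.IsEmbedding j.hom.hom) {c : ((singularChains.{u, v} F).obj j.right).X k}
    (hc : c ∈ smallChains F {Set.range φ.right.hom, Set.range j.hom.hom} k) :
    ∃ a b, c = chainMap F φ.right k a + chainMap F j.hom k b := by
  suffices smallChains F {Set.range φ.right.hom, Set.range j.hom.hom} k ≤
      LinearMap.range (chainMap F φ.right k) ⊔ LinearMap.range (chainMap F j.hom k) by
    obtain ⟨_, ⟨a, rfl⟩, _, ⟨b, rfl⟩, h⟩ := Submodule.mem_sup.1 (this hc)
    exact ⟨a, b, h.symm⟩
  refine Submodule.span_le.2 ?_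
  rintro _ ⟨σ, ⟨U, rfl | rfl, hU⟩, rfl⟩
  · exact Submodule.mem_sup_left (singularSimplex_mem_range_chainMap hφ hU)
  · exact Submodule.mem_sup_right (singularSimplex_mem_range_chainMap hj hU)

/-- A chain that comes both from A and from B comes from A ∩ B, by comparing supports. -/
lemma exists_chainMap_eq_of_chainMap_eq {φ : i ⟶ j} (hφ : Topology.IsEmbedding φ.right.hom)
    (hi : Topology.IsEmbedding i.hom.hom) (hj : Topology.IsEmbedding j.hom.hom)
    (hinter : Set.range φ.right.hom ∩ Set.range j.hom.hom ⊆ Set.range (i.hom ≫ φ.right).hom)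
    {a : ((singularChains.{u, v} F).obj i.right).X k}
    {b : ((singularChains.{u, v} F).obj j.left).X k}
    (hab : chainMap F φ.right k a = chainMap F j.hom k b) :
    ∃ e, chainMap F i.hom k e = a := by
  have : Mono φ.right := (TopCat.mono_iff_injective _).2 hφ.injective
  have h₁ := (mem_range_chainMap_iff hφ _).1 ⟨a, rfl⟩
  have h₂ := (mem_range_chainMap_iff hj _).1 ⟨b, hab.symm⟩
  obtain ⟨e, he⟩ := (mem_range_chainMap_iff (f := i.hom ≫ φ.right) (hφ.comp hi) _).2
    fun σ hσ => (Set.subset_inter (h₁ σ hσ) (h₂ σ hσ)).trans hinter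
  rw [chainMap_comp] at he
  exact ⟨e, chainMap_injective φ.right k he⟩

/-- **Excision**: the inclusion of pairs `(A, A ∩ B) ⟶ (Y, B)` induces an isomorphism on relative
homology if the interiors of `A` and `B` cover `Y`. -/
theorem bijective_relHomology_map_of_excision {φ : i ⟶ j} [Mono i.hom] [Mono j.hom]
    (hφ : Topology.IsEmbedding φ.right.hom)
    (hi : Topology.IsEmbedding i.hom.hom) (hj : Topology.IsEmbedding j.hom.hom)
    (hinter : Set.range φ.right.hom ∩ Set.range j.hom.hom ⊆ Set.range (i.hom ≫ φ.right).hom)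
    (hcover : interior (Set.range φ.right.hom) ∪ interior (Set.range j.hom.hom) = Set.univ)
    (k : ℕ) : Function.Bijective ((relHomology F k).map φ).hom := by
  have h𝒰 : ⋃ U ∈ ({Set.range φ.right.hom, Set.range j.hom.hom} : Set (Set j.right)),
      interior U = Set.univ := by
    rw [Set.biUnion_pair, hcover]
  have hcomm {l : ℕ} (e) : chainMap F φ.right l (chainMap F i.hom l e) =
      chainMap F j.hom l (chainMap F φ.left l e) := by
    rw [← chainMap_comp, ← chainMap_comp]
    exact congr(chainMap F $(φ.w) l e).symm
  constructor
  · rw [injective_iff_map_eq_zero]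
    intro h h0
    obtain ⟨a, ha⟩ := exists_relRepresents h
    obtain ⟨u, b, hub⟩ := (ha.map φ).eq_zero_iff.1 h0
    obtain ⟨m, hm⟩ := exists_iterate_mem_smallChains h𝒰 u
    obtain ⟨u', u'', hu⟩ := exists_eq_add_of_mem_smallChains hφ hj (hm m le_rfl)
    have hsd : chainMap F φ.right k ((singularSd F _ k)^[m] a) =
        chainD F j.right (k + 1) k ((singularSd F _ (k + 1))^[m] u) +
          chainMap F j.hom k ((singularSd F _ k)^[m] b) := by
      rw [singularSd_iterate_chainMap, singularSd_iterate_chainMap, singularSd_iterate_chainD, hub,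
        ← Module.End.pow_apply, ← Module.End.pow_apply, ← Module.End.pow_apply, map_add]
    -- After subdivision the bounding chain splits as u' in A plus u'' in B. The subdivided a minus
    -- Du' is a chain of A that also equals a chain of B, so it comes from A ∩ B and the class of a
    -- is zero.
    obtain ⟨e, he⟩ := exists_chainMap_eq_of_chainMap_eq hφ hi hj hinter (k := k)
      (a := (singularSd F _ k)^[m] a - chainD F i.right (k + 1) k u')
      (b := chainD F j.left (k + 1) k u'' + (singularSd F _ k)^[m] b) (by
        rw [map_sub, map_add, hsd, hu, map_add, chainMap_chainD, chainMap_chainD]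
        abel)
    refine (ha.singularSd_iterate m).eq_zero_iff.2 ⟨u', e, ?_⟩
    rw [he]
    abel
  · intro h
    obtain ⟨c, hc⟩ := exists_relRepresents h
    obtain ⟨m, hm⟩ := exists_iterate_mem_smallChains h𝒰 c
    have hc' := hc.singularSd_iterate m
    obtain ⟨a, b, hab⟩ := exists_eq_add_of_mem_smallChains hφ hj (hm m le_rfl)
    rw [hab] at hc'
    -- The part a in A is a cycle relative to A ∩ B: its boundary lies in A, and it differs from the
    -- boundary of a + b, which lies in B, by the boundary of b.
    obtain ⟨h', hh'⟩ := exists_relRepresents_of_cycle (i := i) (c := a) fun l => by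
      obtain ⟨q, hq⟩ := hc'.exists_chainD_eq l
      refine exists_chainMap_eq_of_chainMap_eq hφ hi hj hinter (b := q - chainD F _ k l b) ?_
      rw [map_sub, hq, map_add, chainMap_chainD, chainMap_chainD]
      abel
    refine ⟨h', ((hh'.map φ).eq_iff hc').2 ⟨0, -b, ?_⟩⟩
    rw [map_zero, map_neg]
    abel

end Excision

/-! ### The long exact sequence of a pair -/

section LongExactSequence

variable (F : Type v) [Field F] {i j : Arrow TopCat.{u}}

/-- The map of the sequences of pairs induced by a map of pairs. -/
def pairSequenceMap (φ : i ⟶ j) : pairSequence.{u, v} F i ⟶ pairSequence F j :=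
  ShortComplex.homMk ((singularChains F).map φ.left) ((singularChains F).map φ.right)
    ((relChains F).map φ)
    (by simp only [pairSequence, ← Functor.map_comp]; exact congr((singularChains F).map $(φ.w)))
    (cokernel.π_desc _ _ _).symm

lemma toRel_naturality (k : ℕ) (φ : i ⟶ j) :
    toRel.{u, v} F k i ≫ (relHomology F k).map φ = (homology F k).map φ.right ≫ toRel F k j :=
  ((HomologicalComplex.homologyFunctor _ _ k).map_comp _ _).symm.trans
    ((congrArg (HomologicalComplex.homologyFunctor _ _ k).map
      (pairSequenceMap F φ).comm₂₃.symm).trans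
      ((HomologicalComplex.homologyFunctor _ _ k).map_comp _ _))

lemma connecting_naturality (k : ℕ) (φ : i ⟶ j) [Mono i.hom] [Mono j.hom] :
    connecting.{u, v} F k i ≫ (homology F k).map φ.left =
      (relHomology F (k + 1)).map φ ≫ connecting F k j :=
  HomologicalComplex.HomologySequence.δ_naturality (pairSequenceMap F φ)
    (pairSequence_shortExact F i) (pairSequence_shortExact F j) _ _ _

variable {F} {k : ℕ}

lemma toRel_map_hom (x : (homology.{u, v} F k).obj i.left) :
    (toRel F k i).hom (((homology F k).map i.hom).hom x) = 0 := by
  have h := ((HomologicalComplex.homologyFunctor _ _ k).map_comp _ _).symm.trans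
    (congrArg (HomologicalComplex.homologyFunctor _ _ k).map (pairSequence F i).zero)
  rw [Functor.map_zero] at h
  exact congr(($h).hom x)

variable [Mono i.hom]

lemma exists_map_hom_eq {x : (homology.{u, v} F k).obj i.right} (hx : (toRel F k i).hom x = 0) :
    ∃ y, ((homology F k).map i.hom).hom y = x :=
  (ShortComplex.moduleCat_exact_iff _).1 ((pairSequence_shortExact F i).homology_exact₂ k) x hx

lemma connecting_toRel (x : (homology.{u, v} F (k + 1)).obj i.right) :
    (connecting F k i).hom ((toRel F (k + 1) i).hom x) = 0 :=
  congr($((pairSequence_shortExact F i).comp_δ (k + 1) k (by simp)).hom x)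

lemma exists_toRel_eq {x : (relHomology.{u, v} F (k + 1)).obj i}
    (hx : (connecting F k i).hom x = 0) : ∃ y, (toRel F (k + 1) i).hom y = x :=
  (ShortComplex.moduleCat_exact_iff _).1
    ((pairSequence_shortExact F i).homology_exact₃ (k + 1) k (by simp)) x hx

lemma map_hom_connecting (x : (relHomology.{u, v} F (k + 1)).obj i) :
    ((homology F k).map i.hom).hom ((connecting F k i).hom x) = 0 :=
  congr($((pairSequence_shortExact F i).δ_comp (k + 1) k (by simp)).hom x)

variable (F) in
-- In degree 0 nothing lies below, so surjectivity on chains passes to homology.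
lemma toRel_zero_surjective (i : Arrow TopCat.{u}) [Mono i.hom] :
    Function.Surjective (toRel.{u, v} F 0 i).hom := by
  have : Epi ((pairSequence.{u, v} F i).g.f 0) :=
    (ModuleCat.epi_iff_surjective _).2 (relProj_surjective F i 0)
  have := HomologicalComplex.epi_homologyMap_of_epi_of_not_rel (pairSequence.{u, v} F i).g 0
    (by simp)
  exact (ModuleCat.epi_iff_surjective (toRel F 0 i)).1 this

variable [Mono j.hom]

/-- A map of pairs that induces isomorphisms on the homology of the spaces induces an isomorphism
on relative homology. -/
lemma bijective_relHomology_map_of_isIso (φ : i ⟶ j)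
    (hl : ∀ k, IsIso ((homology.{u, v} F k).map φ.left))
    (hr : ∀ k, IsIso ((homology.{u, v} F k).map φ.right)) (k : ℕ) :
    Function.Bijective ((relHomology F k).map φ).hom := by
  have := HomologicalComplex.HomologySequence.isIso_homologyMap_τ₃ (pairSequenceMap F φ)
    (pairSequence_shortExact F i) (pairSequence_shortExact F j) k
    (by have := hl k; exact inferInstanceAs (Epi ((homology F k).map φ.left)))
    (hr k) (fun l _ => hl l)
    (fun l _ => by have := hr l; exact inferInstanceAs (Mono ((homology F l).map φ.right)))
  have : IsIso ((relHomology F k).map φ) := this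
  exact ConcreteCategory.bijective_of_isIso ((relHomology F k).map φ)

end LongExactSequence

/-! ### Pairs of subspaces -/

section Subspaces

variable {F : Type v} [Field F] {X : Type u} [TopologicalSpace X]

lemma isEmbedding_pair_hom {Q P : Set X} (h : Q ⊆ P) :
    Topology.IsEmbedding (pair h).hom.hom :=
  Topology.IsEmbedding.inclusion h

lemma relHomology_map_pairMap_comp {Q P Q' P' Q'' P'' : Set X} {h : Q ⊆ P} {h' : Q' ⊆ P'}
    {h'' : Q'' ⊆ P''} (hQ : Q ⊆ Q') (hP : P ⊆ P') (hQ' : Q' ⊆ Q'') (hP' : P' ⊆ P'') (k : ℕ)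
    (x : (relHomology.{u, v} F k).obj (pair h)) :
    ((relHomology F k).map (pairMap h' h'' hQ' hP')).hom
      (((relHomology F k).map (pairMap h h' hQ hP)).hom x) =
      ((relHomology F k).map (pairMap h h'' (hQ.trans hQ') (hP.trans hP'))).hom x :=
  congr($((relHomology F k).map_comp (pairMap h h' hQ hP) (pairMap h' h'' hQ' hP')).hom x).symm

/-- **Excision** for subspaces. -/
theorem bijective_relHomology_map_pairMap_of_excision {A B C Y U V : Set X}
    (hCA : C ⊆ A) (hCB : C ⊆ B) (hAY : A ⊆ Y) (hBY : B ⊆ Y) (hC : A ∩ B ⊆ C)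
    (hU : IsOpen U) (hV : IsOpen V) (hUA : Y ∩ U ⊆ A) (hVB : Y ∩ V ⊆ B) (hUV : Y ⊆ U ∪ V) (k : ℕ) :
    Function.Bijective ((relHomology.{u, v} F k).map (pairMap hCA hBY hCB hAY)).hom := by
  refine bijective_relHomology_map_of_excision (Topology.IsEmbedding.inclusion hAY)
    (isEmbedding_pair_hom _) (isEmbedding_pair_hom _) ?_ ?_ k
  · rintro _ ⟨⟨a, rfl⟩, ⟨b, hb⟩⟩
    exact ⟨⟨a.1, hC ⟨a.2, (congrArg Subtype.val hb) ▸ b.2⟩⟩, rfl⟩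
  · rw [Set.eq_univ_iff_forall]
    intro y
    rcases hUV y.2 with hy | hy
    · refine .inl (mem_interior.2 ⟨Subtype.val ⁻¹' U, fun z hz => ?_,
        hU.preimage continuous_subtype_val, hy⟩)
      exact ⟨⟨z.1, hUA ⟨z.2, hz⟩⟩, rfl⟩
    · refine .inr (mem_interior.2 ⟨Subtype.val ⁻¹' V, fun z hz => ?_,
        hV.preimage continuous_subtype_val, hy⟩)
      exact ⟨⟨z.1, hVB ⟨z.2, hz⟩⟩, rfl⟩

/-- If `U` can be deformed into `L` by a homotopy that preserves `L`, then the inclusion of `L`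
in `U` induces an isomorphism on homology. -/
theorem isIso_homology_map_of_deformation {L U : Set X} (hLU : L ⊆ U) (H : X × ℝ → X)
    (hH : ContinuousOn H (U ×ˢ Set.Icc 0 1)) (hU : ∀ x ∈ U, ∀ t ∈ Set.Icc (0 : ℝ) 1, H (x, t) ∈ U)
    (hL : ∀ x ∈ L, ∀ t ∈ Set.Icc (0 : ℝ) 1, H (x, t) ∈ L)
    (h0 : ∀ x ∈ U, H (x, 0) = x) (h1 : ∀ x ∈ U, H (x, 1) ∈ L) (k : ℕ) :
    IsIso ((homology.{u, v} F k).map (pair hLU).hom) := by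
  have hcont (s : Set X) (hs : s ⊆ U) :
      Continuous fun p : unitInterval × s => H (p.2.1, p.1.1) := by
    refine hH.comp_continuous (by fun_prop) fun p => ⟨hs p.2.2, p.1.2⟩
  let r : (pair hLU).right ⟶ (pair hLU).left := TopCat.ofHom
    ⟨fun x => ⟨H (x.1, 1), h1 x.1 x.2⟩, by
      refine Continuous.subtype_mk ?_ _
      exact (hcont U subset_rfl).comp (f := fun x : U => ((1 : unitInterval), x)) (by fun_prop)⟩
  let HU : TopCat.Homotopy (𝟙 (pair hLU).right) (r ≫ (pair hLU).hom) :=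
    { toFun := fun p => ⟨H (p.2.1, p.1.1), hU _ p.2.2 _ p.1.2⟩
      continuous_toFun := (hcont U subset_rfl).subtype_mk _
      map_zero_left := fun x => Subtype.ext (h0 x.1 x.2)
      map_one_left := fun x => rfl }
  let HL : TopCat.Homotopy (𝟙 (pair hLU).left) ((pair hLU).hom ≫ r) :=
    { toFun := fun p => ⟨H (p.2.1, p.1.1), hL _ p.2.2 _ p.1.2⟩
      continuous_toFun := (hcont L hLU).subtype_mk _
      map_zero_left := fun x => Subtype.ext (h0 x.1 (hLU x.2))
      map_one_left := fun x => rfl }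
  have eU : (homology F k).map (𝟙 (pair hLU).right) = (homology F k).map (r ≫ (pair hLU).hom) :=
    HU.congr_homologyMap_singularChainComplexFunctor (ModuleCat.of F (ULift.{u} F)) k
  have eL : (homology F k).map (𝟙 (pair hLU).left) = (homology F k).map ((pair hLU).hom ≫ r) :=
    HL.congr_homologyMap_singularChainComplexFunctor (ModuleCat.of F (ULift.{u} F)) k
  rw [CategoryTheory.Functor.map_id, Functor.map_comp] at eU eL
  exact ⟨(homology F k).map r, eL.symm, eU.symm⟩

theorem bijective_relHomology_map_pairMap_of_isIso {L U Y : Set X} (hLU : L ⊆ U)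
    (hLY : L ⊆ Y) (hUY : U ⊆ Y) (h : ∀ k, IsIso ((homology.{u, v} F k).map (pair hLU).hom))
    (k : ℕ) :
    Function.Bijective ((relHomology.{u, v} F k).map (pairMap hLY hUY hLU subset_rfl)).hom := by
  have hr (k : ℕ) : IsIso ((homology.{u, v} F k).map (pairMap hLY hUY hLU subset_rfl).right) :=
    (inferInstance : IsIso ((homology.{u, v} F k).map (𝟙 (TopCat.of Y))))
  exact bijective_relHomology_map_of_isIso (pairMap hLY hUY hLU subset_rfl) h hr k

end Subspaces

open Metric Set

/-! ### Radial projection -/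

section Radial

variable {E : Type*} [NormedAddCommGroup E] [NormedSpace ℝ E] {q y : E}

/-- The homotopy from the identity to the radial projection of the unit ball to the unit sphere,
centered at a point `q` of the ball. -/
def radial (q : E) (p : E × ℝ) : E :=
  q + ((1 - p.2) + p.2 * (gauge {v | q + v ∈ ball (0 : E) 1} (p.1 - q))⁻¹) • (p.1 - q)

omit [NormedSpace ℝ E] in
lemma translate_ball_eq (q : E) : {v | q + v ∈ ball (0 : E) 1} = (q + ·) ⁻¹' ball 0 1 := rfl

lemma convex_translate_ball (q : E) : Convex ℝ {v | q + v ∈ ball (0 : E) 1} :=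
  (convex_ball (0 : E) 1).translate_preimage_right q

omit [NormedSpace ℝ E] in
lemma translate_ball_mem_nhds (hq : q ∈ ball (0 : E) 1) :
    {v | q + v ∈ ball (0 : E) 1} ∈ nhds 0 := by
  refine (isOpen_ball.preimage (continuous_const.add continuous_id)).mem_nhds ?_
  simpa using hq

/-- The translated ball is bounded, so its gauge vanishes only at the origin; `radial` may therefore
divide by it away from q. -/
lemma gauge_translate_ball_pos (hq : q ∈ ball (0 : E) 1) (hy : y ≠ q) :
    0 < gauge {v | q + v ∈ ball (0 : E) 1} (y - q) := by
  refine (gauge_pos (absorbent_nhds_zero (translate_ball_mem_nhds hq)) ?_).2 (sub_ne_zero.2 hy)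
  rw [NormedSpace.isVonNBounded_iff]
  refine (isBounded_ball (x := (0 : E)) (r := 1 + ‖q‖)).subset fun v hv => ?_
  rw [mem_ofPred_eq, mem_ball_zero_iff] at hv
  rw [mem_ball_zero_iff]
  have := norm_sub_le (q + v) q
  rw [add_sub_cancel_left] at this
  linarith

/-- The level set 1 of the gauge of a convex neighbourhood of 0 is its frontier. Hence dividing by
the gauge lands on the sphere, and points of the sphere are not moved. -/
lemma gauge_translate_ball_eq_one_iff (hq : q ∈ ball (0 : E) 1) (v : E) :
    gauge {v | q + v ∈ ball (0 : E) 1} v = 1 ↔ q + v ∈ sphere (0 : E) 1 := by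
  rw [gauge_eq_one_iff_mem_frontier (convex_translate_ball q) (translate_ball_mem_nhds hq),
    translate_ball_eq]
  have := (Homeomorph.addLeft q).preimage_frontier (ball (0 : E) 1)
  rw [frontier_ball (0 : E) one_ne_zero] at this
  rw [show ((q + ·) ⁻¹' ball (0 : E) 1) = Homeomorph.addLeft q ⁻¹' ball 0 1 from rfl, ← this]
  rfl

lemma continuousOn_radial (hq : q ∈ ball (0 : E) 1) :
    ContinuousOn (radial q) {p | p.1 ≠ q} := by
  have hg : Continuous fun p : E × ℝ => gauge {v | q + v ∈ ball (0 : E) 1} (p.1 - q) :=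
    (continuous_gauge (convex_translate_ball q) (translate_ball_mem_nhds hq)).comp (by fun_prop)
  have hi : ContinuousOn (fun p : E × ℝ => (gauge {v | q + v ∈ ball (0 : E) 1} (p.1 - q))⁻¹)
      {p | p.1 ≠ q} :=
    hg.continuousOn.inv₀ fun p hp => (gauge_translate_ball_pos hq hp).ne'
  unfold radial
  fun_prop

lemma radial_zero (q y : E) : radial q (y, 0) = y := by simp [radial]

lemma radial_one_mem (hq : q ∈ ball (0 : E) 1) (hy : y ≠ q) :
    radial q (y, 1) ∈ sphere (0 : E) 1 := by
  have hpos := gauge_translate_ball_pos hq hy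
  rw [radial, ← gauge_translate_ball_eq_one_iff hq]
  simp only [sub_self, zero_add, one_mul]
  rw [gauge_smul_of_nonneg (by positivity), smul_eq_mul, inv_mul_cancel₀ hpos.ne']

lemma radial_of_mem_sphere (hq : q ∈ ball (0 : E) 1) (hy : y ∈ sphere (0 : E) 1) (t : ℝ) :
    radial q (y, t) = y := by
  have := (gauge_translate_ball_eq_one_iff hq (y - q)).2 (by simpa using hy)
  simp only [radial, this]
  simp

lemma radial_eq (q y : E) (t : ℝ) :
    radial q (y, t) = (1 - t) • y + t • radial q (y, 1) := by
  simp only [radial]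
  module

lemma radial_mem (hq : q ∈ ball (0 : E) 1) (hy : y ∈ closedBall (0 : E) 1) (hyq : y ≠ q) {t : ℝ}
    (ht : t ∈ Icc (0 : ℝ) 1) : radial q (y, t) ∈ closedBall (0 : E) 1 := by
  rw [radial_eq]
  exact convex_closedBall (0 : E) 1 hy (sphere_subset_closedBall (radial_one_mem hq hyq))
    (by linarith [ht.2]) ht.1 (by ring)

/-- The factor (1 - t) + t / gauge multiplying y - q stays positive for t in [0, 1]. -/
lemma radial_ne (hq : q ∈ ball (0 : E) 1) (hyq : y ≠ q) {t : ℝ}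
    (ht : t ∈ Icc (0 : ℝ) 1) : radial q (y, t) ≠ q := by
  have hpos := inv_pos.2 (gauge_translate_ball_pos hq hyq)
  rw [radial, ne_eq, add_eq_left, smul_eq_zero, not_or]
  refine ⟨ne_of_gt ?_, sub_ne_zero.2 hyq⟩
  dsimp only
  rcases ht.1.eq_or_lt with rfl | h
  · simp
  · have := mul_pos h hpos
    linarith [ht.2]

end Radial

/-! ### Attaching an embedded cube -/

/-- An embedding of the closed unit ball of `ℝ^k` (for the maximum norm) in a space. -/
structure IsCube {Z : Type u} [TopologicalSpace Z] {k : ℕ} (φ : (Fin k → ℝ) → Z) : Prop where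
  continuousOn : ContinuousOn φ (closedBall 0 1)
  injOn : InjOn φ (closedBall 0 1)

namespace IsCube

variable {Z : Type u} [TopologicalSpace Z] [T2Space Z] {k : ℕ} {φ : (Fin k → ℝ) → Z}
  (hφ : IsCube φ)
include hφ

lemma isClosed_image {s : Set (Fin k → ℝ)} (hs : IsClosed s) (hs' : s ⊆ closedBall 0 1) :
    IsClosed (φ '' s) :=
  (((isCompact_closedBall 0 1).of_isClosed_subset hs hs').image_of_continuousOn
    (hφ.continuousOn.mono hs')).isClosed

omit [T2Space Z] in
lemma invFunOn_apply {y : Fin k → ℝ} (hy : y ∈ closedBall (0 : Fin k → ℝ) 1) :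
    Function.invFunOn φ (closedBall 0 1) (φ y) = y :=
  hφ.injOn.leftInvOn_invFunOn hy

/-- A continuous injection of a compact space into a Hausdorff space is a closed map, so its inverse
is continuous on the image. -/
lemma continuousOn_invFunOn :
    ContinuousOn (Function.invFunOn φ (closedBall 0 1)) (φ '' closedBall 0 1) := by
  rw [continuousOn_iff_isClosed]
  intro t ht
  refine ⟨φ '' (t ∩ closedBall 0 1), hφ.isClosed_image (ht.inter isClosed_closedBall)
    inter_subset_right, ?_⟩
  ext x
  constructor
  · rintro ⟨hx, y, hy, rfl⟩
    rw [mem_preimage, hφ.invFunOn_apply hy] at hx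
    exact ⟨⟨y, ⟨hx, hy⟩, rfl⟩, y, hy, rfl⟩
  · rintro ⟨⟨y, ⟨hyt, hy⟩, rfl⟩, -⟩
    exact ⟨by rwa [mem_preimage, hφ.invFunOn_apply hy], y, hy, rfl⟩

/-- The space obtained by attaching a cube to `L`, without an inner point of the cube, has the
homology of `L`. -/
lemma isIso_homology_map_of_attach {F : Type v} [Field F] {L U : Set Z} (hL : IsClosed L)
    (hLφ : ∀ y ∈ closedBall (0 : Fin k → ℝ) 1, φ y ∈ L ↔ y ∈ sphere (0 : Fin k → ℝ) 1)
    {q : Fin k → ℝ} (hq : q ∈ ball (0 : Fin k → ℝ) 1)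
    (hU : U = (L ∪ φ '' closedBall 0 1) \ {φ q}) (hLU : L ⊆ U) (l : ℕ) :
    IsIso ((homology.{u, v} F l).map (pair hLU).hom) := by
  classical
  let ψ := Function.invFunOn φ (closedBall 0 1)
  -- Radial projection on the cube and constant on L. The two agree on the overlap, because L meets
  -- the cube in its boundary sphere, which `radial` fixes.
  let H : Z × ℝ → Z := fun p =>
    if p.1 ∈ φ '' closedBall 0 1 then φ (radial q (ψ p.1, p.2)) else p.1
  have hq' := ball_subset_closedBall hq
  have Hφ {y} (hy : y ∈ closedBall (0 : Fin k → ℝ) 1) (t : ℝ) :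
      H (φ y, t) = φ (radial q (y, t)) := by
    simp only [H, if_pos (mem_image_of_mem φ hy), ψ, hφ.invFunOn_apply hy]
  have HL {x} (hx : x ∈ L) (t : ℝ) : H (x, t) = x := by
    by_cases h : x ∈ φ '' closedBall 0 1
    · obtain ⟨y, hy, rfl⟩ := h
      rw [Hφ hy, radial_of_mem_sphere hq ((hLφ y hy).1 hx)]
    · simp only [H, if_neg h]
  have hφq {y} (hy : y ∈ closedBall (0 : Fin k → ℝ) 1) : φ y ≠ φ q ↔ y ≠ q :=
    (hφ.injOn.eq_iff hy hq').not
  subst hU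
  refine isIso_homology_map_of_deformation hLU H ?_ ?_ ?_ ?_ ?_ l
  · have h1 : ContinuousOn H (L ×ˢ Icc 0 1) :=
      continuousOn_fst.congr fun p hp => HL hp.1 p.2
    have h2 : ContinuousOn H ((φ '' closedBall 0 1 \ {φ q}) ×ˢ Icc 0 1) := by
      have : ContinuousOn (fun p : Z × ℝ => φ (radial q (ψ p.1, p.2)))
          ((φ '' closedBall 0 1 \ {φ q}) ×ˢ Icc 0 1) := by
        have hψ : ContinuousOn (fun p : Z × ℝ => (ψ p.1, p.2))
            ((φ '' closedBall 0 1 \ {φ q}) ×ˢ Icc 0 1) :=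
          (hφ.continuousOn_invFunOn.comp continuousOn_fst fun p hp => hp.1.1).prodMk
            continuousOn_snd
        refine hφ.continuousOn.comp ((continuousOn_radial hq).comp hψ ?_) ?_
        · rintro ⟨_, t⟩ ⟨⟨⟨y, hy, rfl⟩, hyq⟩, ht⟩
          simp only [mem_ofPred_eq, ψ, hφ.invFunOn_apply hy]
          exact (hφq hy).1 hyq
        · rintro ⟨_, t⟩ ⟨⟨⟨y, hy, rfl⟩, hyq⟩, ht⟩
          simp only [ψ, hφ.invFunOn_apply hy]
          exact radial_mem hq hy ((hφq hy).1 hyq) ht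
      exact this.congr fun p hp => by simp only [H, if_pos hp.1.1]
    have hD : IsClosed (φ '' closedBall 0 1) := hφ.isClosed_image isClosed_closedBall subset_rfl
    rw [union_sdiff_distrib, union_prod]
    have hsub : (φ '' closedBall 0 1 \ {φ q}) ×ˢ Icc (0 : ℝ) 1 ⊆
        (φ '' closedBall 0 1) ×ˢ Icc (0 : ℝ) 1 := prod_mono sdiff_subset subset_rfl
    have hsub' : (L \ {φ q}) ×ˢ Icc (0 : ℝ) 1 ⊆ L ×ˢ Icc (0 : ℝ) 1 :=
      prod_mono sdiff_subset subset_rfl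
    intro z hz
    -- Gluing over two relatively closed pieces: continuity within a piece is vacuous at points
    -- outside the closure of that piece.
    refine ContinuousWithinAt.union ?_ ?_
    · by_cases h : z ∈ L ×ˢ Icc (0 : ℝ) 1
      · exact (h1 z h).mono hsub'
      · refine continuousWithinAt_of_notMem_closure fun hz' => h ?_
        exact (closure_minimal hsub' (hL.prod isClosed_Icc)) hz'
    · by_cases h : z ∈ (φ '' closedBall 0 1) ×ˢ Icc (0 : ℝ) 1
      · refine h2 z ⟨⟨h.1, ?_⟩, h.2⟩
        rcases hz with hz | hz <;> exact hz.1.2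
      · refine continuousWithinAt_of_notMem_closure fun hz' => h ?_
        exact (closure_minimal hsub (hD.prod isClosed_Icc)) hz'
  · rintro x ⟨hx | ⟨y, hy, rfl⟩, hxq⟩ t ht
    · rw [HL hx]
      exact ⟨.inl hx, hxq⟩
    · have hyq := (hφq hy).1 hxq
      have := radial_mem hq hy hyq ht
      rw [Hφ hy]
      exact ⟨.inr ⟨_, this, rfl⟩, (hφq this).2 (radial_ne hq hyq ht)⟩
  · intro x hx t _
    rwa [HL hx]
  · rintro x ⟨hx | ⟨y, hy, rfl⟩, hxq⟩
    · rw [HL hx]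
    · rw [Hφ hy, radial_zero]
  · rintro x ⟨hx | ⟨y, hy, rfl⟩, hxq⟩
    · rwa [HL hx]
    · have hs := radial_one_mem hq ((hφq hy).1 hxq)
      rw [Hφ hy]
      exact (hLφ _ (sphere_subset_closedBall hs)).2 hs

section Attach

variable {F : Type v} [Field F] {L Y : Set Z} (hL : IsClosed L)
  (hLφ : ∀ y ∈ closedBall (0 : Fin k → ℝ) 1, φ y ∈ L ↔ y ∈ sphere (0 : Fin k → ℝ) 1)
  (hY : Y = L ∪ φ '' closedBall 0 1)
include hL hLφ hY

/-- The punctured space deforms onto L, so replacing L by it does not change the homology relative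
to it, by the five lemma. -/
lemma bijective_relHomology_map_puncture {q : Fin k → ℝ} (hq : q ∈ ball (0 : Fin k → ℝ) 1)
    (hLY : L ⊆ Y) (hLq : L ⊆ Y \ {φ q}) (l : ℕ) :
    Function.Bijective ((relHomology.{u, v} F l).map
      (pairMap hLY sdiff_subset hLq subset_rfl)).hom :=
  bijective_relHomology_map_pairMap_of_isIso hLq hLY _
    (hφ.isIso_homology_map_of_attach hL hLφ hq (by rw [hY]) hLq) l

/-- The homology of `L ∪ cube` relative to the complement of an inner point of the cube. -/
lemma bijective_relHomology_map_cube_puncture {q : Fin k → ℝ} (hq : q ∈ ball (0 : Fin k → ℝ) 1)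
    {S D : Set Z} (hS : S = φ '' sphere 0 1) (hD : D = φ '' closedBall 0 1)
    (hSD : S ⊆ D) (hDY : D ⊆ Y) (hSq : S ⊆ Y \ {φ q}) (l : ℕ) :
    Function.Bijective ((relHomology.{u, v} F l).map
      (pairMap hSD sdiff_subset hSq hDY)).hom := by
  have hq' := ball_subset_closedBall hq
  have hSc : IsClosed S := hS ▸ hφ.isClosed_image isClosed_sphere sphere_subset_closedBall
  have hSφ : ∀ y ∈ closedBall (0 : Fin k → ℝ) 1, φ y ∈ S ↔ y ∈ sphere (0 : Fin k → ℝ) 1 := by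
    intro y hy
    rw [hS]
    exact hφ.injOn.mem_image_iff sphere_subset_closedBall hy
  have hSq' : S ⊆ D \ {φ q} := fun x hx => ⟨hSD hx, (hSq hx).2⟩
  -- The cube itself is the case where the base is its own boundary sphere S.
  have h1 := hφ.bijective_relHomology_map_puncture (F := F) hSc hSφ
    (Y := D) (by rw [hD, union_eq_self_of_subset_left]; rwa [← hD]) hq hSD hSq' l
  -- Excision from (Y, Y \ φ q) to (D, D \ φ q): outside L one is in the cube, and φ q, being an
  -- inner point, is not in L, so the complements of L and of φ q cover.
  have h2 := bijective_relHomology_map_pairMap_of_excision (F := F) (A := D) (B := Y \ {φ q})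
    (C := D \ {φ q}) (Y := Y) (U := Lᶜ) (V := {φ q}ᶜ) sdiff_subset (sdiff_subset_sdiff_left hDY) hDY
    sdiff_subset (fun x hx => ⟨hx.1, hx.2.2⟩) hL.isOpen_compl isOpen_compl_singleton
    (by rintro x ⟨hx, hx'⟩; rw [hY, ← hD] at hx; exact hx.resolve_left hx')
    (fun x hx => hx)
    (fun x hx => by
      by_cases h : x = φ q
      · left
        rw [h]
        intro hqL
        have h1 := mem_sphere.1 ((hLφ q hq').1 hqL)
        have h2 := mem_ball.1 hq
        linarith
      · exact .inr h) l
  convert h2.comp h1 using 1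
  ext x
  exact (relHomology_map_pairMap_comp _ _ _ _ _ _).symm

/-- The relative homology of `(L ∪ cube, L)` is that of the cube relative to its boundary. -/
lemma bijective_relHomology_map_attach {S D : Set Z} (hS : S = φ '' sphere 0 1)
    (hD : D = φ '' closedBall 0 1) (hSD : S ⊆ D) (hLY : L ⊆ Y) (hSL : S ⊆ L) (hDY : D ⊆ Y)
    (l : ℕ) :
    Function.Bijective ((relHomology.{u, v} F l).map (pairMap hSD hLY hSL hDY)).hom := by
  have hq : (0 : Fin k → ℝ) ∈ ball (0 : Fin k → ℝ) 1 := by simp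
  have hLq : L ⊆ Y \ {φ 0} := by
    refine fun x hx => ⟨hLY hx, ?_⟩
    rintro rfl
    have := (hLφ 0 (by simp)).1 hx
    simp at this
  have h1 := hφ.bijective_relHomology_map_puncture (F := F) hL hLφ hY hq hLY hLq l
  have h2 := hφ.bijective_relHomology_map_cube_puncture (F := F) hL hLφ hY hq hS hD hSD hDY
    (hSL.trans hLq) l
  -- Two out of three for (D, S) → (Y, L) → (Y, Y \ φ 0): the second map and the composite are
  -- bijective.
  refine (Function.Bijective.of_comp_iff' h1 _).1 ?_
  convert h2 using 1
  ext x
  exact relHomology_map_pairMap_comp _ _ _ _ _ _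

end Attach

end IsCube

/-! ### The homology of a cube relative to its boundary -/

section Cyclic

variable {F : Type v} [Field F]

lemma exists_span_singleton_of_injective {V W : Type w} [AddCommGroup V] [Module F V]
    [AddCommGroup W] [Module F W] {f : V →ₗ[F] W} (hf : Function.Injective f)
    (hW : ∃ w : W, Submodule.span F {w} = ⊤) : ∃ w : V, Submodule.span F {w} = ⊤ := by
  have h (V : Type w) [AddCommGroup V] [Module F V] :
      (∃ w : V, Submodule.span F {w} = ⊤) ↔ Module.rank F V ≤ 1 := by
    rw [rank_le_one_iff]
    simp [Submodule.eq_top_iff', Submodule.mem_span_singleton]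
  rw [h] at hW ⊢
  exact (LinearMap.rank_le_of_injective f hf).trans hW

lemma exists_span_singleton_of_surjective {V W : Type*} [AddCommGroup V] [Module F V]
    [AddCommGroup W] [Module F W] {f : V →ₗ[F] W} (hf : Function.Surjective f)
    (hV : ∃ w : V, Submodule.span F {w} = ⊤) : ∃ w : W, Submodule.span F {w} = ⊤ := by
  obtain ⟨w, hw⟩ := hV
  refine ⟨f w, ?_⟩
  rw [← image_singleton, Submodule.span_image, hw, Submodule.map_top, LinearMap.range_eq_top.2 hf]

lemma norm_finCons {k : ℕ} (a : ℝ) (x : Fin k → ℝ) :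
    ‖(Fin.cons a x : Fin (k + 1) → ℝ)‖ = max ‖a‖ ‖x‖ := by
  refine le_antisymm ((pi_norm_le_iff_of_nonneg (by positivity)).2 fun i => ?_) (max_le ?_ ?_)
  · refine Fin.cases ?_ (fun i => ?_) i
    · simp
    · simpa using .inr (norm_le_pi_norm x i)
  · simpa using norm_le_pi_norm (Fin.cons a x : Fin (k + 1) → ℝ) 0
  · refine (pi_norm_le_iff_of_nonneg (by positivity)).2 fun i => ?_
    simpa using norm_le_pi_norm (Fin.cons a x : Fin (k + 1) → ℝ) i.succ

lemma exists_span_singleton_homology_zero (P : TopCat.{u}) [PathConnectedSpace P] :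
    ∃ g : (homology.{u, v} F 0).obj P, Submodule.span F {g} = ⊤ := by
  have := (ConcreteCategory.bijective_of_isIso
    (TopCat.singularHomology₀ε P (ModuleCat.of F (ULift.{u} F)))).1
  refine exists_span_singleton_of_injective
    (f := (TopCat.singularHomology₀ε P (ModuleCat.of F (ULift.{u} F))).hom) this ⟨⟨1⟩, ?_⟩
  rw [Submodule.eq_top_iff']
  intro x
  exact Submodule.mem_span_singleton.2 ⟨x.down, ULift.ext _ _ (by simp)⟩

variable {Z : Type u} [TopologicalSpace Z]

/-- For subspaces `J ⊆ S ⊆ D` such that `J` and `D` have the same homology, the connecting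
homomorphism `H_{k+1}(D, S) ⟶ H_k(S, J)` is injective. -/
lemma connecting_comp_toRel_injective {J S D : Set Z} (hJS : J ⊆ S) (hSD : S ⊆ D)
    (h : ∀ l, IsIso ((homology.{u, v} F l).map (pair (hJS.trans hSD)).hom)) (k : ℕ) :
    Function.Injective (connecting F k (pair hSD) ≫ toRel.{u, v} F k (pair hJS)).hom := by
  have hb (l) := ConcreteCategory.bijective_of_isIso
    ((homology.{u, v} F l).map (pair (hJS.trans hSD)).hom)
  have hcomp (l) (y : (homology.{u, v} F l).obj (TopCat.of J)) :
      ((homology F l).map (pair (hJS.trans hSD)).hom).hom y =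
        ((homology F l).map (pair hSD).hom).hom (((homology F l).map (pair hJS).hom).hom y) :=
    congr($((homology F l).map_comp (pair hJS).hom (pair hSD).hom).hom y)
  rw [injective_iff_map_eq_zero]
  intro x hx
  -- The class δx dies relative to J, so it comes from some y on J. It also dies in D, where the
  -- homology of J embeds, so y = 0 and δx = 0.
  obtain ⟨y, hy⟩ := exists_map_hom_eq (i := pair hJS) (x := (connecting F k (pair hSD)).hom x) hx
  have hy0 : y = 0 := by
    refine (hb k).1 ?_
    refine (hcomp k y).trans ?_
    rw [hy]
    exact (map_hom_connecting x).trans (map_zero _).symm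
  rw [hy0, map_zero] at hy
  -- Now x comes from H(D) = H(J), hence through H(S), and is zero relative to S.
  obtain ⟨w, rfl⟩ := exists_toRel_eq hy.symm
  obtain ⟨w', rfl⟩ := (hb (k + 1)).2 w
  refine (congrArg _ (hcomp (k + 1) w')).trans ?_
  exact toRel_map_hom _

/-! ### The faces of a cube -/

section Faces

variable {k : ℕ}

/-- The union of all faces of the cube of dimension `k + 1`, except for one. -/
def cup (k : ℕ) : Set (Fin (k + 1) → ℝ) := {y | ‖y‖ ≤ 1 ∧ (y 0 = -1 ∨ ‖Fin.tail y‖ = 1)}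

lemma exists_eq_finCons (y : Fin (k + 1) → ℝ) : ∃ (a : ℝ) (x : Fin k → ℝ), y = Fin.cons a x :=
  ⟨y 0, Fin.tail y, (Fin.cons_self_tail y).symm⟩

lemma finCons_mem_cup (a : ℝ) (x : Fin k → ℝ) : (Fin.cons a x : Fin (k + 1) → ℝ) ∈ cup k ↔
    (|a| ≤ 1 ∧ ‖x‖ ≤ 1) ∧ (a = -1 ∨ ‖x‖ = 1) := by
  simp only [cup, mem_ofPred_eq, norm_finCons, max_le_iff, Real.norm_eq_abs, Fin.cons_zero,
    Fin.tail_cons]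

lemma finCons_mem_closedBall (a : ℝ) (x : Fin k → ℝ) : (Fin.cons a x : Fin (k + 1) → ℝ) ∈
    closedBall (0 : Fin (k + 1) → ℝ) 1 ↔ |a| ≤ 1 ∧ ‖x‖ ≤ 1 := by
  rw [mem_closedBall_zero_iff, norm_finCons, max_le_iff, Real.norm_eq_abs]

lemma finCons_mem_sphere (a : ℝ) (x : Fin k → ℝ) : (Fin.cons a x : Fin (k + 1) → ℝ) ∈
    sphere (0 : Fin (k + 1) → ℝ) 1 ↔ (|a| ≤ 1 ∧ ‖x‖ ≤ 1) ∧ (|a| = 1 ∨ ‖x‖ = 1) := by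
  rw [mem_sphere_zero_iff_norm, norm_finCons, Real.norm_eq_abs]
  grind

lemma cup_subset_closedBall : cup k ⊆ closedBall 0 1 := fun y hy => by
  rw [mem_closedBall_zero_iff]; exact hy.1

lemma sphere_eq_cup_union :
    sphere 0 1 = cup k ∪ (fun x => (Fin.cons 1 x : Fin (k + 1) → ℝ)) '' closedBall 0 1 := by
  ext y
  obtain ⟨a, x, rfl⟩ := exists_eq_finCons y
  rw [mem_union, finCons_mem_cup, finCons_mem_sphere]
  have : (Fin.cons a x : Fin (k + 1) → ℝ) ∈
      (fun x => (Fin.cons 1 x : Fin (k + 1) → ℝ)) '' closedBall 0 1 ↔ a = 1 ∧ ‖x‖ ≤ 1 := by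
    constructor
    · rintro ⟨z, hz, hzx⟩
      obtain ⟨rfl, rfl⟩ := Fin.cons_inj.1 hzx
      exact ⟨rfl, mem_closedBall_zero_iff.1 hz⟩
    · rintro ⟨rfl, hx⟩
      exact ⟨x, mem_closedBall_zero_iff.2 hx, rfl⟩
  rw [this]
  grind

lemma isClosed_cup : IsClosed (cup k) := by
  refine (isClosed_le continuous_norm continuous_const).inter
    ((isClosed_eq (continuous_apply 0) continuous_const).union
      (isClosed_eq (Continuous.norm ?_) continuous_const))
  exact continuous_pi fun i => continuous_apply i.succ

/-- The homotopy that moves the cube to its bottom face. -/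
def slide (p : (Fin (k + 1) → ℝ) × ℝ) : Fin (k + 1) → ℝ :=
  Fin.cons ((1 - p.2) * p.1 0 - p.2) (Fin.tail p.1)

lemma slide_finCons (a : ℝ) (x : Fin k → ℝ) (t : ℝ) :
    slide (Fin.cons a x, t) = Fin.cons ((1 - t) * a - t) x := by
  simp [slide]

lemma slide_zero (y : Fin (k + 1) → ℝ) : slide (y, 0) = y := by
  simp [slide]

lemma continuous_slide : Continuous (slide (k := k)) := by
  refine continuous_pi fun i => ?_
  refine Fin.cases ?_ (fun i => ?_) i
  · simp only [slide, Fin.cons_zero]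
    fun_prop
  · simp only [slide, Fin.cons_succ, Fin.tail]
    fun_prop

lemma abs_slide_le {a t : ℝ} (ha : |a| ≤ 1) (ht : t ∈ Icc (0 : ℝ) 1) : |(1 - t) * a - t| ≤ 1 := by
  obtain ⟨h0, h1⟩ := ht
  rw [abs_le] at ha ⊢
  constructor <;> nlinarith

lemma slide_mem_closedBall {y : Fin (k + 1) → ℝ} (hy : y ∈ closedBall (0 : Fin (k + 1) → ℝ) 1)
    {t : ℝ} (ht : t ∈ Icc (0 : ℝ) 1) : slide (y, t) ∈ closedBall (0 : Fin (k + 1) → ℝ) 1 := by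
  obtain ⟨a, x, rfl⟩ := exists_eq_finCons y
  rw [finCons_mem_closedBall] at hy
  rw [slide_finCons, finCons_mem_closedBall]
  exact ⟨abs_slide_le hy.1 ht, hy.2⟩

lemma slide_mem_cup {y : Fin (k + 1) → ℝ} (hy : y ∈ cup k)
    {t : ℝ} (ht : t ∈ Icc (0 : ℝ) 1) : slide (y, t) ∈ cup k := by
  obtain ⟨a, x, rfl⟩ := exists_eq_finCons y
  rw [finCons_mem_cup] at hy
  rw [slide_finCons, finCons_mem_cup]
  refine ⟨⟨abs_slide_le hy.1.1 ht, hy.1.2⟩, hy.2.imp ?_ id⟩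
  rintro rfl
  ring

lemma slide_one_mem_cup {y : Fin (k + 1) → ℝ} (hy : y ∈ closedBall (0 : Fin (k + 1) → ℝ) 1) :
    slide (y, 1) ∈ cup k := by
  obtain ⟨a, x, rfl⟩ := exists_eq_finCons y
  rw [finCons_mem_closedBall] at hy
  rw [slide_finCons, finCons_mem_cup]
  exact ⟨⟨abs_slide_le hy.1 (by simp), hy.2⟩, .inl (by ring)⟩

end Faces

/-- Sliding the first coordinate to -1 pushes the cube to its bottom face and keeps the union of the
faces other than the top one inside itself. -/
lemma IsCube.isIso_homology_map_cup [T2Space Z] {k : ℕ} {φ : (Fin (k + 1) → ℝ) → Z}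
    (hφ : IsCube φ) {J D : Set Z} (hJ : J = φ '' cup k) (hD : D = φ '' closedBall 0 1)
    (hJD : J ⊆ D) (l : ℕ) : IsIso ((homology.{u, v} F l).map (pair hJD).hom) := by
  have hH {y} (hy : y ∈ closedBall (0 : Fin (k + 1) → ℝ) 1) (t : ℝ) :
      φ (slide (Function.invFunOn φ (closedBall 0 1) (φ y), t)) = φ (slide (y, t)) := by
    rw [hφ.invFunOn_apply hy]
  subst hJ hD
  refine isIso_homology_map_of_deformation hJD
    (fun p => φ (slide (Function.invFunOn φ (closedBall 0 1) p.1, p.2))) ?_ ?_ ?_ ?_ ?_ l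
  · refine hφ.continuousOn.comp (continuous_slide.comp_continuousOn
      ((hφ.continuousOn_invFunOn.comp continuousOn_fst fun p hp => hp.1).prodMk
        continuousOn_snd)) ?_
    rintro ⟨_, t⟩ ⟨⟨y, hy, rfl⟩, ht⟩
    dsimp only
    rw [hφ.invFunOn_apply hy]
    exact slide_mem_closedBall hy ht
  · rintro _ ⟨y, hy, rfl⟩ t ht
    exact ⟨_, slide_mem_closedBall hy ht, (hH hy t).symm⟩
  · rintro _ ⟨y, hy, rfl⟩ t ht
    exact ⟨_, slide_mem_cup hy ht, (hH (cup_subset_closedBall hy) t).symm⟩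
  · rintro _ ⟨y, hy, rfl⟩
    exact (hH hy 0).trans (by rw [slide_zero])
  · rintro _ ⟨y, hy, rfl⟩
    exact ⟨_, slide_one_mem_cup hy, (hH hy 1).symm⟩

lemma finCons_one_mem_closedBall {k : ℕ} {x : Fin k → ℝ} (hx : x ∈ closedBall (0 : Fin k → ℝ) 1) :
    (Fin.cons 1 x : Fin (k + 1) → ℝ) ∈ closedBall (0 : Fin (k + 1) → ℝ) 1 := by
  rw [finCons_mem_closedBall]
  exact ⟨by simp, mem_closedBall_zero_iff.1 hx⟩

lemma IsCube.top {k : ℕ} {φ : (Fin (k + 1) → ℝ) → Z} (hφ : IsCube φ) :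
    IsCube fun x => φ (Fin.cons 1 x) where
  continuousOn := hφ.continuousOn.comp (by fun_prop) fun _ hx => finCons_one_mem_closedBall hx
  injOn := fun _ hx _ hy hxy =>
    Fin.cons_right_injective (α := fun _ : Fin (k + 1) => ℝ) (1 : ℝ)
      (hφ.injOn (finCons_one_mem_closedBall hx) (finCons_one_mem_closedBall hy) hxy)

lemma IsCube.top_mem_cup_iff {k : ℕ} {φ : (Fin (k + 1) → ℝ) → Z} (hφ : IsCube φ) {x : Fin k → ℝ}
    (hx : x ∈ closedBall (0 : Fin k → ℝ) 1) :
    φ (Fin.cons 1 x) ∈ φ '' cup k ↔ x ∈ sphere (0 : Fin k → ℝ) 1 := by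
  rw [hφ.injOn.mem_image_iff cup_subset_closedBall (finCons_one_mem_closedBall hx),
    finCons_mem_cup, mem_sphere_zero_iff_norm]
  norm_num
  intro h
  exact h.le

/-- The relative homology of a cube modulo its boundary is generated by one element. -/
theorem exists_span_singleton_relHomology_cube [T2Space Z] {k : ℕ} {φ : (Fin k → ℝ) → Z}
    (hφ : IsCube φ) {S D : Set Z} (hS : S = φ '' sphere 0 1) (hD : D = φ '' closedBall 0 1)
    (hSD : S ⊆ D) :
    ∃ g : (relHomology.{u, v} F k).obj (pair hSD), Submodule.span F {g} = ⊤ := by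
  induction k generalizing S D with
  | zero =>
    have hD' : D = {φ 0} := by
      rw [hD, ← image_singleton]
      congr 1
      ext y
      simp [Subsingleton.elim y 0]
    have : PathConnectedSpace (pair hSD).right := by
      subst hD'
      exact isPathConnected_iff_pathConnectedSpace.1 (isPathConnected_singleton (φ 0))
    -- A cube of dimension 0 is a point, whose H_0 is generated by one element and surjects onto the
    -- relative H_0.
    exact exists_span_singleton_of_surjective (toRel_zero_surjective F (pair hSD))
      (exists_span_singleton_homology_zero (F := F) (pair hSD).right)
  | succ k ih =>
    have hSJ : S = φ '' cup k ∪ (fun x => φ (Fin.cons 1 x)) '' closedBall 0 1 := by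
      rw [hS, sphere_eq_cup_union, image_union, image_image]
    have hJS : φ '' cup k ⊆ S := hSJ ▸ subset_union_left
    have hsub : (fun x : Fin k → ℝ => φ (Fin.cons 1 x)) '' sphere 0 1 ⊆
        (fun x => φ (Fin.cons 1 x)) '' closedBall 0 1 := image_mono sphere_subset_closedBall
    -- With J the union of all faces but the top one, H_{k+1}(D, S) embeds in H_k(S, J), and S is J
    -- with the top face attached along its boundary. So H_k(S, J) is the relative homology of a
    -- cube of one dimension less.
    refine exists_span_singleton_of_injective (connecting_comp_toRel_injective hJS hSD
      (hφ.isIso_homology_map_cup rfl hD _) k) ?_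
    refine exists_span_singleton_of_surjective (hφ.top.bijective_relHomology_map_attach (F := F)
      (hφ.isClosed_image isClosed_cup cup_subset_closedBall) (fun x hx => hφ.top_mem_cup_iff hx)
      hSJ rfl rfl hsub hJS ?_ (by rw [hSJ]; exact subset_union_right) k).2
      (ih hφ.top rfl rfl hsub)
    rintro _ ⟨x, hx, rfl⟩
    exact (hφ.top_mem_cup_iff (sphere_subset_closedBall hx)).2 hx

end Cyclic

open Topology Topology.RelCWComplex

/-! ### Cells of a regular complex -/

section Cells

variable {X : Type u} [TopologicalSpace X] [T2Space X] [CWComplex (Set.univ : Set X)] {k n : ℕ}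

omit [T2Space X] in
lemma eq_of_mem_openCell {m : ℕ} {e : Cell X k} {e' : Cell X m} {x : X} (h : x ∈ openCell k e)
    (h' : x ∈ openCell m e') : (⟨k, e⟩ : Σ n, Cell X n) = ⟨m, e'⟩ :=
  eq_of_not_disjoint_openCell (Set.not_disjoint_iff.2 ⟨x, h, h'⟩)

/-- Injectivity holds on the open ball in any CW complex and on the sphere by regularity. The two
images are disjoint since the frontier lies in the lower skeleton. -/
lemma isCube_map (hreg : IsRegular X) (e : Cell X k) : IsCube (map (C := Set.univ) k e) where
  continuousOn := RelCWComplex.continuousOn k e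
  injOn := by
    rw [← sphere_union_ball, injOn_union sphere_disjoint_ball]
    refine ⟨?_, ?_, ?_⟩
    · rw [injOn_iff_injective]
      exact (hreg.isEmbedding k e).injective
    · rw [← source_eq k e]
      exact (map k e).injOn
    · intro x hx y hy hxy
      refine disjoint_left.1 (disjoint_skeletonLT_openCell (C := Set.univ) (j := e) le_rfl)
        (cellFrontier_subset_skeletonLT k e ⟨x, hx, rfl⟩) ?_
      rw [hxy]
      exact ⟨y, hy, rfl⟩

omit [T2Space X] in
-- A closed cell is covered by finitely many open cells.
lemma subset_closedCell_finite (S : Set X)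
    (hS : ∀ (m : ℕ) (e : Cell X m), (S ∩ openCell m e).Finite) (m : ℕ) (e : Cell X m) :
    (S ∩ closedCell m e).Finite := by
  obtain ⟨I, hI⟩ := CWComplex.cellFrontier_subset_finite_openCell m e
  have : S ∩ closedCell m e ⊆
      (⋃ l ∈ Finset.range m, ⋃ j ∈ I l, S ∩ openCell l j) ∪ (S ∩ openCell m e) := by
    rintro x ⟨hx, hxe⟩
    rw [← cellFrontier_union_openCell_eq_closedCell] at hxe
    rcases hxe with hxe | hxe
    · have := hI hxe
      simp only [mem_iUnion] at this
      obtain ⟨l, hl, j, hj, hxj⟩ := this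
      left
      simp only [mem_iUnion, Finset.mem_range]
      exact ⟨l, hl, j, hj, hx, hxj⟩
    · exact .inr ⟨hx, hxe⟩
  refine Finite.subset (Finite.union ?_ (hS m e)) this
  exact Finite.biUnion (Finset.finite_toSet _) fun l _ =>
    Finite.biUnion (Finset.finite_toSet _) fun j _ => hS l j

/-- Choose the center of each k-cell. Every set of centers meets each closed cell in a finite set
and so is closed; the centers form a closed discrete subset of a compact space. -/
lemma finite_cell (hreg : IsRegular X) (k : ℕ) : Finite (Cell X k) := by
  have := hreg.compact
  let p : Cell X k → X := fun e => map k e 0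
  have hp (e) : p e ∈ openCell k e := map_zero_mem_openCell k e
  have hinj : Function.Injective p := fun e e' h => by
    have := eq_of_mem_openCell (hp e) (h ▸ hp e')
    simpa using this
  have hclosed (S : Set X) (hS : S ⊆ range p) : IsClosed S := by
    rw [CWComplex.closed Set.univ S (subset_univ S)]
    intro m e
    refine (subset_closedCell_finite S (fun l j => Set.Subsingleton.finite ?_) m e).isClosed
    rintro x ⟨hx, hxj⟩ y ⟨hy, hyj⟩
    obtain ⟨a, rfl⟩ := hS hx
    obtain ⟨b, rfl⟩ := hS hy
    have := (eq_of_mem_openCell (hp a) hxj).trans (eq_of_mem_openCell (hp b) hyj).symm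
    simp at this
    rw [this]
  have hd : IsDiscrete (range p) := by
    refine ⟨discreteTopology_iff_forall_isClosed.2 fun S => ?_⟩
    rw [← preimage_image_eq S Subtype.val_injective]
    refine (hclosed _ ?_).preimage continuous_subtype_val
    rintro _ ⟨x, -, rfl⟩
    exact x.2
  have := (hclosed (range p) subset_rfl).isCompact.finite hd
  exact (finite_range_iff hinj).1 this

/-- The union of the skeleton of dimension `n - 1` and some closed `n`-cells. -/
def partialSkeleton (E : Set (Cell X n)) : Set X :=
  skeletonLT (Set.univ : Set X) (n : ℕ) ∪ ⋃ e ∈ E, closedCell n e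

lemma partialSkeleton_univ :
    partialSkeleton (Set.univ : Set (Cell X n)) =
      skeletonLT (Set.univ : Set X) ((n + 1 : ℕ) : ℕ∞) := by
  push_cast
  rw [← skeletonLT_union_iUnion_closedCell_eq_skeletonLT_succ]
  simp [partialSkeleton]

lemma skeletonLT_subset_partialSkeleton (E : Set (Cell X n)) :
    (skeletonLT (Set.univ : Set X) (n : ℕ) : Set X) ⊆ partialSkeleton E :=
  subset_union_left

lemma partialSkeleton_mono {E E' : Set (Cell X n)} (h : E ⊆ E') :
    partialSkeleton E ⊆ partialSkeleton E' :=
  union_subset_union_right _ (biUnion_subset_biUnion_left h)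

lemma partialSkeleton_insert (e : Cell X n) (E : Set (Cell X n)) :
    partialSkeleton (insert e E) = partialSkeleton E ∪ closedCell n e := by
  rw [partialSkeleton, biUnion_insert, partialSkeleton, union_assoc,
    union_comm (closedCell n e)]

lemma disjoint_partialSkeleton_openCell {E : Set (Cell X n)} {e : Cell X n} (he : e ∉ E) :
    Disjoint (partialSkeleton E) (openCell n e) := by
  rw [disjoint_left]
  rintro x (hx | hx) hxe
  · exact disjoint_left.1 (disjoint_skeletonLT_openCell (C := Set.univ) le_rfl) hx hxe
  · simp only [mem_iUnion] at hx
    obtain ⟨e', he', hx⟩ := hx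
    rw [← cellFrontier_union_openCell_eq_closedCell] at hx
    rcases hx with hx | hx
    · exact disjoint_left.1 (disjoint_skeletonLT_openCell (C := Set.univ) le_rfl)
        (cellFrontier_subset_skeletonLT n e' hx) hxe
    · have := eq_of_mem_openCell hx hxe
      simp only [Sigma.mk.injEq, heq_eq_eq, true_and] at this
      exact he (this ▸ he')

lemma isClosed_partialSkeleton (hreg : IsRegular X) (E : Set (Cell X n)) :
    IsClosed (partialSkeleton E) := by
  have := finite_cell hreg n
  exact (skeletonLT (Set.univ : Set X) (n : ℕ)).closed.union
    (E.toFinite.isClosed_biUnion fun e _ => isClosed_closedCell)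

lemma map_mem_partialSkeleton_iff {E : Set (Cell X n)} {e : Cell X n} (he : e ∉ E)
    (y : Fin n → ℝ) (hy : y ∈ closedBall (0 : Fin n → ℝ) 1) :
    map n e y ∈ partialSkeleton E ↔ y ∈ sphere (0 : Fin n → ℝ) 1 := by
  constructor
  · intro h
    rw [← sphere_union_ball] at hy
    exact hy.resolve_right fun hy =>
      disjoint_left.1 (disjoint_partialSkeleton_openCell he) h ⟨y, hy, rfl⟩
  · intro h
    exact skeletonLT_subset_partialSkeleton E (cellFrontier_subset_skeletonLT n e ⟨y, h, rfl⟩)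

/-- The closure is contained in the (n-1)-skeleton together with the closed cells of E, a set that
is closed because there are finitely many cells, and that misses every other open n-cell. -/
lemma openCell_subset_cellClosure_iff (hreg : IsRegular X) {E : Set (Cell X n)} {e : Cell X n} :
    openCell n e ⊆ cellClosure E ↔ e ∈ E := by
  refine ⟨fun h => ?_, fun h => (subset_biUnion_of_mem h).trans subset_closure⟩
  by_contra he
  have : cellClosure E ⊆ partialSkeleton E :=
    closure_minimal (subset_union_of_subset_right
      (biUnion_mono subset_rfl fun e _ => openCell_subset_closedCell n e) _)
      (isClosed_partialSkeleton hreg E)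
  exact disjoint_left.1 (disjoint_partialSkeleton_openCell he)
    (this (h (map_zero_mem_openCell n e))) (map_zero_mem_openCell n e)

lemma closedCell_subset_cellClosure {E : Set (Cell X n)} {e : Cell X n} (he : e ∈ E) :
    closedCell n e ⊆ cellClosure E := by
  rw [← closure_openCell_eq_closedCell]
  exact closure_mono (subset_biUnion_of_mem he)

end Cells

/-! ### The cellular basis -/

section CellularChains

variable {F : Type v} [Field F] {X : Type u} [TopologicalSpace X]

lemma relHomology_eq_zero {Q P : Set X} (h : Q ⊆ P) (h' : P ⊆ Q) {k : ℕ}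
    (x : (relHomology.{u, v} F k).obj (pair h)) : x = 0 := by
  obtain rfl := h.antisymm h'
  obtain ⟨c, hc⟩ := exists_relRepresents x
  refine hc.eq_zero_iff.2 ⟨0, c, ?_⟩
  rw [map_zero, zero_add]
  exact congr((($((singularChains.{u, v} F).map_id (TopCat.of Q))).f k).hom c).symm

/-- Exactness of the sequence of a triple. -/
lemma exists_relHomology_map_eq {Q L Y : Set X} (hQL : Q ⊆ L) (hLY : L ⊆ Y) {k : ℕ}
    {x : (relHomology.{u, v} F k).obj (pair (hQL.trans hLY))}
    (hx : ((relHomology F k).map (pairMap (hQL.trans hLY) hLY hQL subset_rfl)).hom x = 0) :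
    ∃ z : (relHomology.{u, v} F k).obj (pair hQL),
      ((relHomology F k).map (pairMap hQL (hQL.trans hLY) subset_rfl hLY)).hom z = x := by
  obtain ⟨c, hc⟩ : ∃ c : ((singularChains.{u, v} F).obj (pair hLY).right).X k,
    RelRepresents (pair (hQL.trans hLY)) k c x := exists_relRepresents x
  obtain ⟨u, l, hul⟩ := (hc.map (pairMap (hQL.trans hLY) hLY hQL subset_rfl)).eq_zero_iff.1 hx
  replace hul : c = chainD F (pair hLY).right (k + 1) k u + chainMap F (pair hLY).hom k l :=
    congr((($((singularChains.{u, v} F).map_id (TopCat.of Y))).f k).hom c).symm.trans hul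
  have hd (m) : chainD F (pair hLY).right k m c =
      chainD F (pair hLY).right k m (chainMap F (pair hLY).hom k l) := by
    rw [hul, map_add, chainD_chainD, zero_add]
  obtain ⟨z, hz⟩ := exists_relRepresents_of_cycle (F := F) (i := pair hQL) (c := l) fun m => by
    obtain ⟨q, hq⟩ := hc.exists_chainD_eq m
    exact ⟨q, chainMap_injective (F := F) (pair hLY).hom m
      ((chainMap_comp (pair hQL).hom (pair hLY).hom m q).symm.trans
        (hq.trans ((hd m).trans (chainMap_chainD (pair hLY).hom k m l).symm)))⟩
  have h2 : chainMap F (pair hLY).hom k l - c = chainD F (pair hLY).right (k + 1) k (-u) + 0 := by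
    rw [hul, map_neg]
    abel
  exact ⟨z, ((hz.map (pairMap hQL (hQL.trans hLY) subset_rfl hLY)).eq_iff hc).2
    ⟨-u, 0, h2.trans (congrArg (_ + ·) (map_zero _).symm)⟩⟩

variable [T2Space X] [CWComplex (Set.univ : Set X)] {n : ℕ}

/-- The choice made in `orientation` is a generator only because one exists, which holds since a
closed cell of a regular complex is an embedded cube. -/
lemma span_orientation (hreg : IsRegular X) (e : Cell X n) :
    Submodule.span F {orientation.{u, v} F e} = ⊤ :=
  Classical.epsilon_spec (exists_span_singleton_relHomology_cube (isCube_map hreg e) rfl rfl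
    (cellFrontier_subset_closedCell n e))

lemma relHomology_map_cell_mem_span (hreg : IsRegular X) (e : Cell X n)
    (y : (relHomology.{u, v} F n).obj (pair (cellFrontier_subset_closedCell n e))) :
    ((relHomology F n).map (pairMap (cellFrontier_subset_closedCell n e)
      (skeletonLT_mono (by simp)) (cellFrontier_subset_skeletonLT n e)
      (closedCell_subset_skeletonLT n e))).hom y ∈
        Submodule.span F (range (cellClass F (X := X) (k := n))) := by
  have hy := (span_orientation.{u, v} (F := F) hreg e).ge (Submodule.mem_top (x := y))
  obtain ⟨r, rfl⟩ := Submodule.mem_span_singleton.1 hy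
  have he : cellClass.{u, v} F e ∈ Submodule.span F (range (cellClass F (X := X) (k := n))) :=
    Submodule.subset_span ⟨e, rfl⟩
  exact Set.mem_of_eq_of_mem (map_smul _ r _) (Submodule.smul_mem _ r he)

/-- The cellular chains are spanned by the cells. -/
theorem span_range_cellClass (hreg : IsRegular X) :
    Submodule.span F (range (cellClass F (X := X) (k := n))) = ⊤ := by
  have hfin := finite_cell hreg n
  -- The n-cells are attached one at a time to the lower skeleton. Keeping Y as a variable with an
  -- equation lets it be specialised to the full skeleton without transport between homology groups.
  suffices ∀ (E : Set (Cell X n)) (Y : Set X) (_ : Y = partialSkeleton E)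
      (hQY : (skeletonLT (Set.univ : Set X) (n : ℕ) : Set X) ⊆ Y)
      (hYX : Y ⊆ skeletonLT (Set.univ : Set X) ((n + 1 : ℕ) : ℕ∞))
      (x : (relHomology.{u, v} F n).obj (pair hQY)),
      ((relHomology.{u, v} F n).map (pairMap hQY
        (skeletonLT_mono (by simp)) subset_rfl hYX)).hom x ∈
        Submodule.span F (range (cellClass F (X := X) (k := n))) by
    rw [Submodule.eq_top_iff']
    intro x
    refine Set.mem_of_eq_of_mem ?_ (this univ _ partialSkeleton_univ.symm _ subset_rfl x)
    exact congr($((relHomology.{u, v} F n).map_id (skeletonPair X n)).hom x).symm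
  intro E
  induction E, E.toFinite using Set.Finite.induction_on with
  | empty =>
    intro Y hY hQY hYX x
    rw [relHomology_eq_zero hQY (by simp [hY, partialSkeleton]) x, map_zero]
    exact zero_mem _
  | @insert e E he _ ih =>
    rintro _ rfl hQY hYX x
    have hQL := skeletonLT_subset_partialSkeleton E
    have hLY : partialSkeleton E ⊆ partialSkeleton (insert e E) :=
      partialSkeleton_mono (subset_insert e E)
    have hDY : closedCell n e ⊆ partialSkeleton (insert e E) := by
      rw [partialSkeleton_insert]
      exact subset_union_right
    have hSL : cellFrontier n e ⊆ partialSkeleton E :=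
      (cellFrontier_subset_skeletonLT n e).trans hQL
    obtain ⟨y, hy⟩ := ((isCube_map hreg e).bijective_relHomology_map_attach (F := F)
      (isClosed_partialSkeleton hreg E) (map_mem_partialSkeleton_iff he)
      (partialSkeleton_insert e E) rfl rfl (cellFrontier_subset_closedCell n e) hLY hSL hDY n).2
      (((relHomology F n).map (pairMap (hQL.trans hLY) hLY hQL subset_rfl)).hom x)
    let y' := ((relHomology F n).map (pairMap (cellFrontier_subset_closedCell n e)
      (hQL.trans hLY) (cellFrontier_subset_skeletonLT n e) hDY)).hom y
    -- Modulo the earlier cells x agrees with a class y' of the new cell, so x - y' comes from the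
    -- earlier stage by the exact sequence of the triple.
    obtain ⟨z, hz⟩ := exists_relHomology_map_eq hQL hLY (x := x - y') (by
      rw [map_sub, ← hy, sub_eq_zero]
      exact (relHomology_map_pairMap_comp _ _ _ _ _ _).symm)
    rw [← sub_add_cancel x y', map_add, ← hz]
    refine add_mem ?_ ?_
    · exact Set.mem_of_eq_of_mem (relHomology_map_pairMap_comp _ _ _ _ _ _)
        (ih _ rfl hQL (hLY.trans hYX) z)
    · exact Set.mem_of_eq_of_mem (relHomology_map_pairMap_comp _ _ _ _ _ _)
        (relHomology_map_cell_mem_span hreg e y)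

end CellularChains

/-! ### Coefficients of cellular chains -/

section Coefficients

lemma relHomology_map_pairMap_eq_zero {F : Type v} [Field F] {X : Type u} [TopologicalSpace X]
    {Q P Q' P' : Set X} {h : Q ⊆ P} {h' : Q' ⊆ P'} (hQ : Q ⊆ Q') (hP : P ⊆ P') (hPQ' : P ⊆ Q')
    {k : ℕ} (x : (relHomology.{u, v} F k).obj (pair h)) :
    ((relHomology F k).map (pairMap h h' hQ hP)).hom x = 0 := by
  have hx := relHomology_map_pairMap_comp (h' := (subset_rfl : Q' ⊆ Q')) (h'' := h') hQ hPQ'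
    subset_rfl h' k x
  rw [relHomology_eq_zero _ subset_rfl (((relHomology F k).map _).hom x), map_zero] at hx
  exact hx.symm

variable {F : Type v} [Field F] {X : Type u} [TopologicalSpace X] [T2Space X]
  [CWComplex (Set.univ : Set X)] {n : ℕ} {p : X}

/-- The map from cellular chains to the local homology of a skeleton at a point. -/
def localize (hp : p ∉ (skeletonLT (Set.univ : Set X) (n : ℕ) : Set X)) :
    CellularChain.{u, v} X F n →ₗ[F] (relHomology.{u, v} F n).obj
      (pair (sdiff_subset : (skeletonLT (Set.univ : Set X) ((n + 1 : ℕ) : ℕ∞) : Set X) \ {p} ⊆ _)) :=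
  ((relHomology F n).map (pairMap (skeletonLT_mono (by simp)) sdiff_subset
    (subset_sdiff_singleton (skeletonLT_mono (by simp)) hp) subset_rfl)).hom

lemma notMem_skeletonLT_of_mem_openCell {e : Cell X n} (hp : p ∈ openCell n e) :
    p ∉ (skeletonLT (Set.univ : Set X) (n : ℕ) : Set X) := fun h =>
  disjoint_left.1 (disjoint_skeletonLT_openCell (C := Set.univ) le_rfl) h hp

lemma cellFrontier_subset_skeletonLT_sdiff
    (hp : p ∉ (skeletonLT (Set.univ : Set X) (n : ℕ) : Set X)) (e : Cell X n) :
    cellFrontier n e ⊆ (skeletonLT (Set.univ : Set X) ((n + 1 : ℕ) : ℕ∞) : Set X) \ {p} :=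
  (cellFrontier_subset_skeletonLT n e).trans
    (subset_sdiff_singleton (skeletonLT_mono (by simp)) hp)

lemma localize_cellClass (hp : p ∉ (skeletonLT (Set.univ : Set X) (n : ℕ) : Set X))
    (e : Cell X n) : localize hp (cellClass.{u, v} F e) =
      ((relHomology F n).map (pairMap (cellFrontier_subset_closedCell n e) sdiff_subset
        (cellFrontier_subset_skeletonLT_sdiff hp e)
        (closedCell_subset_skeletonLT n e))).hom (orientation F e) :=
  relHomology_map_pairMap_comp _ _ _ _ _ _

lemma localize_cellClass_eq_zero (hp : p ∉ (skeletonLT (Set.univ : Set X) (n : ℕ) : Set X))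
    {e : Cell X n} (hpe : p ∉ closedCell n e) : localize hp (cellClass.{u, v} F e) = 0 := by
  rw [localize_cellClass]
  exact relHomology_map_pairMap_eq_zero _ _
    (subset_sdiff_singleton (closedCell_subset_skeletonLT n e) hpe) _

/-- At an inner point, the homology of the closed cell modulo its frontier maps isomorphically to
the local homology of the skeleton, so the multiple of the orientation is already zero. Concluding r
• e = 0 instead of r = 0 avoids having to know that the orientation is nonzero. -/
lemma smul_cellClass_eq_zero (hreg : IsRegular X) {e : Cell X n} (hpe : p ∈ openCell n e) {r : F}
    (h : r • localize (notMem_skeletonLT_of_mem_openCell hpe) (cellClass.{u, v} F e) = 0) :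
    r • cellClass.{u, v} F e = 0 := by
  have hr : r • orientation.{u, v} F e = 0 := by
    obtain ⟨q, hq, rfl⟩ := hpe
    rw [localize_cellClass] at h
    -- All other n-cells are put into the base, so that the n-skeleton arises from it by attaching
    -- the single cube e.
    have he : e ∉ ({e}ᶜ : Set (Cell X n)) := by simp
    have hY : (skeletonLT (Set.univ : Set X) ((n + 1 : ℕ) : ℕ∞) : Set X) =
        partialSkeleton {e}ᶜ ∪ closedCell n e := by
      rw [← partialSkeleton_insert, ← partialSkeleton_univ]
      congr
      ext a
      simp [em]
    refine ((isCube_map hreg e).bijective_relHomology_map_cube_puncture (F := F)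
      (isClosed_partialSkeleton hreg {e}ᶜ) (map_mem_partialSkeleton_iff he) hY hq rfl rfl
      (cellFrontier_subset_closedCell n e) (closedCell_subset_skeletonLT n e)
      (cellFrontier_subset_skeletonLT_sdiff
        (notMem_skeletonLT_of_mem_openCell ⟨q, hq, rfl⟩) e) n).1 ?_
    exact (map_smul _ r _).trans (h.trans (map_zero _).symm)
  exact (map_smul _ r (orientation.{u, v} F e)).symm.trans ((congrArg _ hr).trans (map_zero _))

/-- The boundary of e comes from the homology of its frontier, which lies in the n-skeleton minus p.
A class from there is zero relative to that punctured skeleton. -/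
lemma localize_boundary_cellClass (hp : p ∉ (skeletonLT (Set.univ : Set X) (n : ℕ) : Set X))
    {e : Cell X (n + 1)} (hpe : p ∉ cellFrontier (n + 1) e) :
    localize hp (boundary X F n (cellClass.{u, v} F e)) = 0 := by
  let j := pair (sdiff_subset :
    (skeletonLT (Set.univ : Set X) ((n + 1 : ℕ) : ℕ∞) : Set X) \ {p} ⊆ _)
  let φ : pair (cellFrontier_subset_closedCell (n + 1) e) ⟶ skeletonPair X (n + 1) :=
    pairMap (cellFrontier_subset_closedCell (n + 1) e) _
      (cellFrontier_subset_skeletonLT (n + 1) e) (closedCell_subset_skeletonLT (n + 1) e)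
  let ψ : skeletonPair X n ⟶ j := pairMap (skeletonLT_mono (by simp)) sdiff_subset
    (subset_sdiff_singleton (skeletonLT_mono (by simp)) hp) subset_rfl
  let y := (connecting.{u, v} F n (pair (cellFrontier_subset_closedCell (n + 1) e))).hom
    (orientation F e)
  let g : TopCat.of (cellFrontier (n + 1) e) ⟶ j.left :=
    (pair (subset_sdiff_singleton (cellFrontier_subset_skeletonLT (n + 1) e) hpe)).hom
  have h1 : (connecting.{u, v} F n (skeletonPair X (n + 1))).hom (cellClass F e) =
      ((homology F n).map φ.left).hom y :=
    congr($(connecting_naturality.{u, v} F n φ).hom (orientation F e)).symm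
  have h2 : boundary X F n (cellClass.{u, v} F e) =
      (toRel.{u, v} F n (skeletonPair X n)).hom (((homology F n).map φ.left).hom y) :=
    congrArg _ h1
  have h3 : localize hp ((toRel.{u, v} F n (skeletonPair X n)).hom
      (((homology F n).map φ.left).hom y)) =
      (toRel.{u, v} F n j).hom (((homology F n).map ψ.right).hom
        (((homology F n).map φ.left).hom y)) :=
    congr($(toRel_naturality.{u, v} F n ψ).hom (((homology F n).map φ.left).hom y))
  have h4 : ((homology.{u, v} F n).map ψ.right).hom (((homology F n).map φ.left).hom y) =
      ((homology F n).map j.hom).hom (((homology F n).map g).hom y) :=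
    congr($(((homology.{u, v} F n).map_comp φ.left ψ.right).symm.trans
      ((homology.{u, v} F n).map_comp g j.hom)).hom y)
  rw [h2, h3, h4]
  exact toRel_map_hom _

/-- Expand w in cells. A cell not inside A has an inner point p outside A; since all other n-cells
die at p, the vanishing of w at p kills the term of that cell. -/
lemma mem_chainsIn_of_localize (hreg : IsRegular X) {A : Set X} {w : CellularChain.{u, v} X F n}
    (h : ∀ p (hp : p ∉ (skeletonLT (Set.univ : Set X) (n : ℕ) : Set X)), p ∉ A →
      localize hp w = 0) : w ∈ chainsIn F n A := by
  have := finite_cell hreg n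
  have := Fintype.ofFinite (Cell X n)
  have hw : w ∈ Submodule.span F (range (cellClass F (X := X) (k := n))) :=
    (span_range_cellClass hreg).ge Submodule.mem_top
  obtain ⟨c, rfl⟩ := (Submodule.mem_span_range_iff_exists_fun F).1 hw
  refine Submodule.sum_mem _ fun e _ => ?_
  by_cases he : openCell n e ⊆ A
  · exact Submodule.smul_mem _ _ (Submodule.subset_span ⟨e, he, rfl⟩)
  · obtain ⟨p, hpe, hpA⟩ := not_subset.1 he
    rw [smul_cellClass_eq_zero hreg hpe (r := c e)]
    · exact zero_mem _
    have hp := notMem_skeletonLT_of_mem_openCell hpe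
    have hs := h p hp hpA
    rw [map_sum, Finset.sum_eq_single e, map_smul] at hs
    · exact hs
    · intro e' _ he'
      rw [map_smul, localize_cellClass_eq_zero, smul_zero]
      intro hpe'
      refine disjoint_left.1 (disjoint_partialSkeleton_openCell (E := {e'}) (e := e) ?_) ?_ hpe
      · simpa using he'.symm
      · exact .inr (mem_biUnion rfl hpe')
    · simp

/-- A chain that bounds both cells in `E` and cells in `E'` lies in both closures. -/
lemma span_boundary_cellClass_inf_le (hreg : IsRegular X) (E E' : Set (Cell X (n + 1))) :
    Submodule.span F ((fun e => boundary X F n (cellClass.{u, v} F e)) '' E) ⊓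
      Submodule.span F ((fun e => boundary X F n (cellClass.{u, v} F e)) '' E') ≤
      chainsIn F n (cellClosure E ∩ cellClosure E') := by
  have key (E : Set (Cell X (n + 1))) (p) (hp : p ∉ (skeletonLT (Set.univ : Set X) (n : ℕ) : Set X))
      (hpE : p ∉ cellClosure E) :
      Submodule.span F ((fun e => boundary X F n (cellClass.{u, v} F e)) '' E) ≤
        LinearMap.ker (localize hp) := by
    rw [Submodule.span_le]
    rintro _ ⟨e, he, rfl⟩
    exact localize_boundary_cellClass hp fun h => hpE
      (closedCell_subset_cellClosure he (cellFrontier_subset_closedCell _ e h))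
  rintro w ⟨hw, hw'⟩
  refine mem_chainsIn_of_localize hreg fun p hp hpA => ?_
  by_cases hpE : p ∈ cellClosure E
  · exact key E' p hp (fun h => hpA ⟨hpE, h⟩) hw'
  · exact key E p hp hpE hw

end Coefficients

/-! ### Boundaries are cycles -/

section Augmentation

open Simplicial

/-- The augmentation of the homology of simplicial sets is natural. -/
lemma homologyMap_homology₀ε {C : Type u} [Category.{v} C] [HasCoproducts.{w} C] [Preadditive C]
    [CategoryWithHomology C] {X Y : SSet.{w}} (R : C) (f : X ⟶ Y) :
    SSet.homologyMap f R 0 ≫ Y.homology₀ε R = X.homology₀ε R := by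
  -- In degree 0 every chain is a cycle. As s and the projection to homology are epimorphisms, the
  -- two maps can be compared on single vertices.
  let s : (X.chainComplex R).X 0 ⟶ (X.chainComplex R).cycles 0 :=
    (X.chainComplex R).liftCycles (𝟙 _) 0 (by simp) (by simp)
  have hs : (X.chainComplex R).iCycles 0 ≫ s = 𝟙 _ := by
    rw [← cancel_mono ((X.chainComplex R).iCycles 0)]
    simp [s]
  have : Epi s := by
    have : Epi ((X.chainComplex R).iCycles 0 ≫ s) := by rw [hs]; infer_instance
    exact epi_of_epi ((X.chainComplex R).iCycles 0) s
  rw [← cancel_epi ((X.chainComplex R).homologyπ 0), ← cancel_epi s]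
  refine SSet.chainComplex_hom_ext fun x => ?_
  have hx : X.ιChainComplex x ≫ s =
      (X.chainComplex R).liftCycles (X.ιChainComplex x) 0 (by simp) (by simp) := by
    rw [← cancel_mono ((X.chainComplex R).iCycles 0)]
    simp [s]
  have hf : (X.chainComplex R).liftCycles (X.ιChainComplex x) 0 (by simp) (by simp) ≫
      HomologicalComplex.cyclesMap (SSet.chainComplexMap f R) 0 =
      (Y.chainComplex R).liftCycles (Y.ιChainComplex (f.app _ x)) 0 (by simp) (by simp) := by
    rw [← cancel_mono ((Y.chainComplex R).iCycles 0)]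
    simp
  rw [reassoc_of% hx, reassoc_of% hx, SSet.liftCycles_ιChainComplex_homologyπ_homology₀ε,
    HomologicalComplex.homologyπ_naturality_assoc, reassoc_of% hf,
    SSet.liftCycles_ιChainComplex_homologyπ_homology₀ε]

lemma homology_map_singularHomology₀ε {F : Type v} [Field F] {P Q : TopCat.{u}} (f : P ⟶ Q)
    (x : (homology.{u, v} F 0).obj P) :
    (TopCat.singularHomology₀ε Q (ModuleCat.of F (ULift.{u} F))).hom
        (((homology F 0).map f).hom x) =
      (TopCat.singularHomology₀ε P (ModuleCat.of F (ULift.{u} F))).hom x :=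
  congr(($(homologyMap_homology₀ε (ModuleCat.of F (ULift.{u} F)) (TopCat.toSSet.map f))).hom x)

end Augmentation

/-! ### Cellular boundaries are reduced cycles; boundaries of closures of sets of cells. -/

section Boundaries

variable (F : Type v) [Field F] {X : Type u} [TopologicalSpace X] [T2Space X]
  [CWComplex (Set.univ : Set X)]

/-- In positive degree ∂∂ contains two consecutive maps of a long exact sequence. In degree 0, the
connecting map followed by X^0 → X^1 is zero, and the augmentation of X^0 factors through that of
X^1 by naturality. -/
lemma boundary_mem_reducedCycles (n : ℕ) (x : CellularChain.{u, v} X F (n + 1)) :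
    boundary X F n x ∈ reducedCycles X F n := by
  cases n with
  | zero =>
    have hx : boundary.{u, v} X F 0 x = (toRel.{u, v} F 0 (skeletonPair X 0)).hom
      ((connecting.{u, v} F 0 (skeletonPair X (0 + 1))).hom x) := rfl
    rw [hx]
    refine Submodule.mem_map_of_mem ?_
    have h := map_hom_connecting x
    exact (homology_map_singularHomology₀ε (skeletonPair X (0 + 1)).hom _).symm.trans
      ((congrArg _ h).trans (map_zero _))
  | succ n =>
    have h : (connecting.{u, v} F n (skeletonPair X (n + 1))).hom
        ((toRel.{u, v} F (n + 1) (skeletonPair X (n + 1))).hom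
          ((connecting.{u, v} F (n + 1) (skeletonPair X (n + 1 + 1))).hom x)) = 0 :=
      connecting_toRel (i := skeletonPair X (n + 1)) _
    exact (congrArg (toRel F n (skeletonPair X n)).hom h).trans (map_zero _)

variable {F} {n : ℕ}

lemma boundariesIn_cellClosure (hreg : IsRegular X) (E : Set (Cell X (n + 1))) :
    boundariesIn F n (cellClosure E) =
      Submodule.span F ((fun e => boundary X F n (cellClass.{u, v} F e)) '' E) := by
  rw [boundariesIn, chainsIn, Submodule.map_span]
  congr 1
  ext x
  simp only [openCell_subset_cellClosure_iff hreg]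
  constructor
  · rintro ⟨_, ⟨e, he, rfl⟩, rfl⟩
    exact ⟨e, he, rfl⟩
  · rintro ⟨e, he, rfl⟩
    exact ⟨_, ⟨e, he, rfl⟩, rfl⟩

lemma boundariesIn_cellClosure_inter (hreg : IsRegular X) {E E' : Set (Cell X (n + 1))}
    (h : Disjoint E E') :
    boundariesIn F n (cellClosure E ∩ cellClosure E') =
      (⊥ : Submodule F (CellularChain.{u, v} X F n)) := by
  rw [boundariesIn, chainsIn, Submodule.map_span, Submodule.span_eq_bot]
  rintro _ ⟨_, ⟨e, he, rfl⟩, rfl⟩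
  rw [subset_inter_iff, openCell_subset_cellClosure_iff hreg,
    openCell_subset_cellClosure_iff hreg] at he
  exact (disjoint_left.1 h he.1 he.2).elim

end Boundaries

/-! ### The rank formula -/

section Matroid

variable {F : Type*} [Field F] {α V : Type*} [AddCommGroup V] [Module F V] {v : α → V}

lemma linearMatroid_indep_iff {I : Set α} : (linearMatroid F v).Indep I ↔ LinearIndepOn F v I := by
  simp [linearMatroid]

/-- A matroid basis of S has the same span as S: a column outside its span could be added to it
without losing independence. -/
lemma linearMatroid_eRk (S : Set α) :
    (linearMatroid F v).eRk S =
      Cardinal.toENat (Module.rank F (Submodule.span F (v '' S))) := by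
  obtain ⟨I, hI⟩ := (linearMatroid F v).exists_isBasis' S
  have hind := linearMatroid_indep_iff.1 hI.indep
  have hspan : Submodule.span F (v '' S) = Submodule.span F (v '' I) := by
    refine le_antisymm (Submodule.span_le.2 ?_) (Submodule.span_mono (Set.image_mono hI.subset))
    rintro _ ⟨e, he, rfl⟩
    by_contra hne
    exact hne (Submodule.subset_span ⟨e, hI.mem_of_insert_indep he
      (linearMatroid_indep_iff.2 (hind.insert hne)), rfl⟩)
  rw [← hI.encard_eq_eRk, hspan, Set.image_eq_range, rank_span hind,
    Set.toENat_cardinalMk, ← Set.image_eq_range, hind.injOn.encard_image]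

lemma linearMatroid_eRank_add {S T : Set α} (h : S ∪ T = Set.univ) :
    (linearMatroid F v).eRank + Cardinal.toENat (Module.rank F
        (Submodule.span F (v '' S) ⊓ Submodule.span F (v '' T) : Submodule F V)) =
      (linearMatroid F v).eRk S + (linearMatroid F v).eRk T := by
  have hE : (linearMatroid F v).E = S ∪ T := h.symm
  rw [Matroid.eRank_def, hE, linearMatroid_eRk, linearMatroid_eRk, linearMatroid_eRk,
    ← map_add, ← map_add, Set.image_union, Submodule.span_union,
    Submodule.rank_sup_add_rank_inf_eq]

end Matroid

/-! ### The nullity as the dimension of a space of common boundaries. -/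

section Nullity

variable {F : Type v} [Field F] {X : Type u} [TopologicalSpace X] [T2Space X]
  [Topology.CWComplex (Set.univ : Set X)] {k : ℕ} {A B : Set X}

/-- A class of A ∩ B lies in the kernel if and only if its cycle bounds in A and in B. By `h` every
common boundary occurs as such a cycle, and by `h₀` distinct ones have distinct classes. -/
lemma nullity_eq (h₀ : boundariesIn F k (A ∩ B) = (⊥ : Submodule F (CellularChain.{u, v} X F k)))
    (h : boundariesIn F k A ⊓ boundariesIn F k B ≤ cyclesIn F k (A ∩ B)) :
    nullity F k A B = Cardinal.toENat (Module.rank F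
      (boundariesIn F k A ⊓ boundariesIn F k B : Submodule F (CellularChain.{u, v} X F k))) := by
  let g := ((boundariesIn F k (A ∩ B)).comap (cyclesIn F k (A ∩ B)).subtype).mkQ ∘ₗ
    Submodule.inclusion h
  have hg : Function.Injective g := by
    rw [injective_iff_map_eq_zero]
    intro x hx
    have hx' : (x : CellularChain.{u, v} X F k) ∈ boundariesIn F k (A ∩ B) :=
      (Submodule.Quotient.mk_eq_zero
        ((boundariesIn F k (A ∩ B)).comap (cyclesIn F k (A ∩ B)).subtype)).1 hx
    rw [h₀] at hx'
    exact Subtype.ext hx'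
  have hr : LinearMap.range g = LinearMap.ker
      ((inclusionMap F k (A := A ∩ B) (B := A) Set.inter_subset_left).prod
        (inclusionMap F k (A := A ∩ B) (B := B) Set.inter_subset_right)) := by
    ext x
    obtain ⟨z, rfl⟩ := Submodule.mkQ_surjective _ x
    rw [LinearMap.ker_prod, Submodule.mem_inf, LinearMap.mem_ker, LinearMap.mem_ker]
    constructor
    · rintro ⟨w, hw⟩
      rw [← hw]
      exact ⟨(Submodule.Quotient.mk_eq_zero _).2 w.2.1, (Submodule.Quotient.mk_eq_zero _).2 w.2.2⟩
    · rintro ⟨h1, h2⟩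
      exact ⟨⟨z, (Submodule.Quotient.mk_eq_zero
        ((boundariesIn F k A).comap (cyclesIn F k A).subtype)).1 h1,
        (Submodule.Quotient.mk_eq_zero
          ((boundariesIn F k B).comap (cyclesIn F k B).subtype)).1 h2⟩, rfl⟩
  rw [nullity, ← hr, (LinearEquiv.ofInjective g hg).rank_eq]

end Nullity

end CellularMatroid

end

/-- The top dimension is n + 1, so the boundaries lie in degree n. The additive form avoids
truncated subtraction in `ℕ∞`; all terms are finite by `finite_cell`. -/
theorem mainTheorem1 {X : Type*} [TopologicalSpace X] [T2Space X]
    [Topology.CWComplex (Set.univ : Set X)] (F : Type*) [Field F] (n : ℕ)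
    (hreg : CellularMatroid.IsRegular X) (hdim : CellularMatroid.IsOfDim X (n + 1))
    (E₁ E₂ : Set (CellularMatroid.Cell X (n + 1)))
    (hunion : E₁ ∪ E₂ = Set.univ) (hdisj : Disjoint E₁ E₂)
    (hE₁ : E₁.Nonempty) (hE₂ : E₂.Nonempty) :
    (CellularMatroid.cellularMatroid X F (n + 1)).eRank +
        CellularMatroid.nullity F n
          (CellularMatroid.cellClosure E₁) (CellularMatroid.cellClosure E₂) =
      (CellularMatroid.cellularMatroid X F (n + 1)).eRk E₁ +
        (CellularMatroid.cellularMatroid X F (n + 1)).eRk E₂ := by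
  have h : CellularMatroid.boundariesIn F n (CellularMatroid.cellClosure E₁) ⊓
      CellularMatroid.boundariesIn F n (CellularMatroid.cellClosure E₂) ≤
      CellularMatroid.cyclesIn F n
        (CellularMatroid.cellClosure E₁ ∩ CellularMatroid.cellClosure E₂) := by
    refine le_inf ?_ (inf_le_left.trans ?_)
    · rw [CellularMatroid.boundariesIn_cellClosure hreg,
        CellularMatroid.boundariesIn_cellClosure hreg]
      exact CellularMatroid.span_boundary_cellClass_inf_le hreg E₁ E₂
    · rintro _ ⟨x, -, rfl⟩
      exact CellularMatroid.boundary_mem_reducedCycles F n x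
  rw [CellularMatroid.nullity_eq (CellularMatroid.boundariesIn_cellClosure_inter hreg hdisj) h,
    CellularMatroid.boundariesIn_cellClosure hreg,
    CellularMatroid.boundariesIn_cellClosure hreg]
  exact CellularMatroid.linearMatroid_eRank_add hunion
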